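/- Proposition 5.2 with Corollary 5.3 (invariance of $X$-colorings under handlebody-knot moves). A biquandle is a set $X$ with operations $\underline{\triangleright},\overline{\triangleright}:X\times X\to X$ such that $x\underline{\triangleright}x=x\overline{\triangleright}x$; the maps $x\mapsto x\underline{\triangleright}y$, $x\mapsto x\overline{\triangleright}y$ (each $y$) and $(x,y)\mapsto(y\overline{\triangleright}x,\,x\underline{\triangleright}y)$ are bijective; and $(x\underline{\triangleright}y)\underline{\triangleright}(z\underline{\triangleright}y)=(x\underline{\triangleright}z)\underline{\triangleright}(y\overline{\triangleright}z)$, $(x\underline{\triangleright}y)\overline{\triangleright}(z\underline{\triangleright}y)=(x\overline{\triangleright}z)\underline{\triangleright}(y\overline{\triangleright}z)$, $(x\overline{\triangleright}y)\overline{\triangleright}(z\overline{\triangleright}y)=(x\overline{\triangleright}z)\overline{\triangleright}(y\underline{\triangleright}z)$. A partially multiplicative biquandle is a biquandle $X$ with a subset $D\subset X\times X$ and a map $D\to X$, $(a,b)\mapsto ab$, such that (i) $x\mapsto ax$ and $x\mapsto xb$ are injective where defined; (ii) $(a,b\underline{\triangleright}a)\in D\Leftrightarrow(b,a\overline{\triangleright}b)\in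 D$, and then $a(b\underline{\triangleright}a)=b(a\overline{\triangleright}b)$; (iii) $(a,b)\in D\Leftrightarrow(a\underline{\triangleright}x,b\underline{\triangleright}(x\overline{\triangleright}a))\in D\Leftrightarrow(a\overline{\triangleright}x,b\overline{\triangleright}(x\underline{\triangleright}a))\in D$, and then $x\underline{\triangleright}(ab)=(x\underline{\triangleright}a)\underline{\triangleright}b$, $(ab)\underline{\triangleright}x=(a\underline{\triangleright}x)(b\underline{\triangleright}(x\overline{\triangleright}a))$, $x\overline{\triangleright}(ab)=(x\overline{\triangleright}a)\overline{\triangleright}b$, $(ab)\overline{\triangleright}x=(a\overline{\triangleright}x)(b\overline{\triangleright}(x\underline{\triangleright}a))$; (iv) $(a,b),(ab,c)\in D\Leftrightarrow(b,c),(a,bc)\in D$, and then $(ab)c=a(bc)$; (v) $(a,b),(c,d)\in D$ and $ab=cd$ if and only if there is $e\in X$ with $(a,e),(e,d)\in D$, $ae=c$, $ed=b$. A $Y$-oriented spatial trivalent graph diagram is a finite planar diagram, with crossings, of a trivalent graph (possibly with circle components) in $\mathbb R^3$, considered as a combinatorial planar diagram, together with a direction of every edge such that no vertex is a source or a sink.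 Its semiarcs are the pieces between consecutive crossing points (over or under) and vertices. An $X$-coloring assigns elements of $X$ to the semiarcs such that - at each crossing, if the under-semiarc lying to the left of the over-strand is colored $x$ and the over-semiarc lying to the left of the under-strand is colored $y$, then the other under- and over-semiarcs are colored $x\underline{\triangleright}y$ and $y\overline{\triangleright}x$, respectively; - at each vertex, where two edges merge into one or one splits into two, if the two edges are colored $a$ (left) and $b$ (right), as seen along their direction, then $(a,b)\in D$ and the one edge is colored $ab$. The handlebody-knot Reidemeister moves are the local moves I (kink), II, III (the moves of link diagrams), IV (crossing two legs of a vertex), V (moving a strand over or under a vertex) and VI (the IH-move: replacing an edge joining two vertices by an edge joining the other neighboring pairs of the four legs), in all rotations and mirror images, in both directions, and with all $Y$-orientations of the two sides which agree on the boundary of the disk of the move. Let $X$ be a partially multiplicative biquandle. 1. If $\Gamma$ is a $Y$-oriented spatial trivalent graph diagram with an $X$-coloring and $\Gamma'$ is obtained from $\Gamma$ by a handlebody-knot Reidemeister move, then there is a unique $X$-coloring of $\Gamma'$ which agrees with the coloring of $\Gamma$ outside the neighborhood of the move. 2. Consequently, the number (cardinality of the set) of $X$-colorings is invariant under the handlebody-knot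 Reidemeister moves: if $\Gamma$ and $\Gamma'$ are related by a finite sequence of such moves, that is, if they represent the same $S^1$-oriented handlebody-knot, then they have equally many $X$-colorings. -/

import Mathlib

universe u

/-- A biquandle: a set with two operations `passUnder` (written `x ▹ᵤ y`) and
`passOver` (written `x ▹ₒ y`). -/
class Biquandle (X : Type u) where
  passUnder : X → X → X
  passOver : X → X → X
  under_self : ∀ x, passUnder x x = passOver x x
  over_bijective : ∀ y, Function.Bijective fun x => passOver x y
  under_bijective : ∀ y, Function.Bijective fun x => passUnder x y
  switch_bijective : Function.Bijective fun p : X × X => (passOver p.2 p.1, passUnder p.1 p.2)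
  exchange_uu : ∀ x y z,
    passUnder (passUnder x y) (passUnder z y) = passUnder (passUnder x z) (passOver y z)
  exchange_uo : ∀ x y z,
    passOver (passUnder x y) (passUnder z y) = passUnder (passOver x z) (passOver y z)
  exchange_oo : ∀ x y z,
    passOver (passOver x y) (passOver z y) = passOver (passOver x z) (passUnder y z)

infixl:70 " ▹ᵤ " => Biquandle.passUnder
infixl:70 " ▹ₒ " => Biquandle.passOver

/-- A partially multiplicative biquandle. The partial multiplication is defined on the pairs
`(a, b)` with `D a b`. -/
class PartiallyMultiplicativeBiquandle (X : Type u) extends Biquandle X where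
  D : X → X → Prop
  mul : ∀ a b, D a b → X
  mul_left_injective : ∀ a x y (hx : D a x) (hy : D a y), mul a x hx = mul a y hy → x = y
  mul_right_injective : ∀ b x y (hx : D x b) (hy : D y b), mul x b hx = mul y b hy → x = y
  D_swap : ∀ a b, D a (b ▹ᵤ a) ↔ D b (a ▹ₒ b)
  mul_swap : ∀ a b (h : D a (b ▹ᵤ a)) (h' : D b (a ▹ₒ b)), mul a (b ▹ᵤ a) h = mul b (a ▹ₒ b) h'
  D_under : ∀ a b x, D a b ↔ D (a ▹ᵤ x) (b ▹ᵤ (x ▹ₒ a))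
  D_over : ∀ a b x, D a b ↔ D (a ▹ₒ x) (b ▹ₒ (x ▹ᵤ a))
  under_mul : ∀ a b x (h : D a b), x ▹ᵤ mul a b h = (x ▹ᵤ a) ▹ᵤ b
  over_mul : ∀ a b x (h : D a b), x ▹ₒ mul a b h = (x ▹ₒ a) ▹ₒ b
  mul_under : ∀ a b x (h : D a b) (h' : D (a ▹ᵤ x) (b ▹ᵤ (x ▹ₒ a))),
    mul a b h ▹ᵤ x = mul (a ▹ᵤ x) (b ▹ᵤ (x ▹ₒ a)) h'
  mul_over : ∀ a b x (h : D a b) (h' : D (a ▹ₒ x) (b ▹ₒ (x ▹ᵤ a))),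
    mul a b h ▹ₒ x = mul (a ▹ₒ x) (b ▹ₒ (x ▹ᵤ a)) h'
  D_assoc : ∀ a b c,
    (∃ h : D a b, D (mul a b h) c) ↔ (∃ h : D b c, D a (mul b c h))
  mul_assoc : ∀ a b c (h₁ : D a b) (h₂ : D (mul a b h₁) c) (h₃ : D b c) (h₄ : D a (mul b c h₃)),
    mul (mul a b h₁) c h₂ = mul a (mul b c h₃) h₄
  mul_eq_mul_iff : ∀ a b c d,
    (∃ (h : D a b) (h' : D c d), mul a b h = mul c d h') ↔
      ∃ e, ∃ (h : D a e) (h' : D e d), mul a e h = c ∧ mul e d h' = b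

/-- `IsProd a b c`: the product `ab` is defined and equal to `c`. -/
def IsProd {X : Type u} [PartiallyMultiplicativeBiquandle X] (a b c : X) : Prop :=
  ∃ h : PartiallyMultiplicativeBiquandle.D a b, PartiallyMultiplicativeBiquandle.mul a b h = c

/-- The places where an end of an arc can be attached in a diagram with crossings `C`, trivalent
vertices `V` and `n` endpoints on the boundary circle: four ports at every crossing, three at
every vertex (both numbered counterclockwise), one at every boundary point. At a crossing the
strand through the ports `0` and `2` passes under the strand through the ports `1` and `3`. -/
abbrev Port (C V : Type) (n : ℕ) : Type := (C × Fin 4) ⊕ (V × Fin 3) ⊕ Fin n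

/-- An unoriented spatial trivalent graph diagram in a disk, given combinatorially, with `n`
endpoints on the boundary circle, numbered counterclockwise. `E` is the set of arcs into which the
diagram is cut by its crossing points and its vertices, and `arc p` is the arc with an end at the
port `p`. Every arc has two ends or is a closed curve without ends. -/
structure Picture (n : ℕ) where
  C : Type
  V : Type
  E : Type
  finite_C : Finite C
  finite_V : Finite V
  finite_E : Finite E
  arc : Port C V n → E
  ends : ∀ p, ∃! q, q ≠ p ∧ arc q = arc p

namespace Picture

variable {n : ℕ}

/-- The arc at port `i` of the crossing `c`. -/
abbrev arcC (P : Picture n) (c : P.C) (i : Fin 4) : P.E := P.arc (Sum.inl (c, i))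

/-- The arc at port `i` of the vertex `v`. -/
abbrev arcV (P : Picture n) (v : P.V) (i : Fin 3) : P.E := P.arc (Sum.inr (Sum.inl (v, i)))

/-- The arc at the boundary point `i`. -/
abbrev arcB (P : Picture n) (i : Fin n) : P.E := P.arc (Sum.inr (Sum.inr i))

/-- A `Y`-orientation: a direction of every edge of the graph such that no vertex is a source or
a sink. `inward p` says that the arc at `p` is directed towards the port `p`. Directions are
constant along arcs and along the strands through a crossing. (Closed curves without
crossings and vertices need no data: both directions give the same combinatorial diagram.) -/
structure YOrientation (P : Picture n) where
  inward : Port P.C P.V n → Bool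
  arc_dir : ∀ p q, p ≠ q → P.arc p = P.arc q → inward p ≠ inward q
  crossing_dir : ∀ (c : P.C) (i : Fin 4), inward (Sum.inl (c, i)) ≠ inward (Sum.inl (c, i + 2))
  vertex_dir : ∀ v : P.V, (∃ i : Fin 3, inward (Sum.inr (Sum.inl (v, i))) = true) ∧
    ∃ i : Fin 3, inward (Sum.inr (Sum.inl (v, i))) = false

namespace YOrientation

variable {P : Picture n}

abbrev inC (o : P.YOrientation) (c : P.C) (i : Fin 4) : Bool := o.inward (Sum.inl (c, i))

abbrev inV (o : P.YOrientation) (v : P.V) (i : Fin 3) : Bool :=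
  o.inward (Sum.inr (Sum.inl (v, i)))

abbrev inB (o : P.YOrientation) (i : Fin n) : Bool := o.inward (Sum.inr (Sum.inr i))

/-- The port of the under-strand at `c` which lies on the left of the directed over-strand. -/
def leftUnder (o : P.YOrientation) (c : P.C) : Fin 4 := if o.inC c 1 then 0 else 2

/-- The port of the over-strand at `c` which lies on the left of the directed under-strand. -/
def leftOver (o : P.YOrientation) (c : P.C) : Fin 4 := if o.inC c 0 then 3 else 1

/-- `X`-colorings of a `Y`-oriented diagram. At a crossing, if `x` (under) and `y` (over) are the
colors of the two semiarcs around the corner to the left of both strands, then the semiarcs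
opposite to them are colored `x ▹ᵤ y` and `y ▹ₒ x`. At a vertex `v`, the port `i` of the edge
whose direction differs from that of the other two is colored by the product `ab` of the colors
`a` and `b` of the edges on the left and on the right, as seen along the direction of the edges. -/
structure IsColoring {X : Type u} [PartiallyMultiplicativeBiquandle X] (o : P.YOrientation)
    (f : P.E → X) : Prop where
  under_rule : ∀ c, f (P.arcC c (o.leftUnder c + 2)) =
    f (P.arcC c (o.leftUnder c)) ▹ᵤ f (P.arcC c (o.leftOver c))
  over_rule : ∀ c, f (P.arcC c (o.leftOver c + 2)) =
    f (P.arcC c (o.leftOver c)) ▹ₒ f (P.arcC c (o.leftUnder c))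
  merge : ∀ v i, o.inV v (i + 1) = true → o.inV v (i + 2) = true → o.inV v i = false →
    IsProd (f (P.arcV v (i + 1))) (f (P.arcV v (i + 2))) (f (P.arcV v i))
  split : ∀ v i, o.inV v (i + 1) = false → o.inV v (i + 2) = false → o.inV v i = true →
    IsProd (f (P.arcV v (i + 2))) (f (P.arcV v (i + 1))) (f (P.arcV v i))

end YOrientation

/-- The counterclockwise next port at the same crossing or vertex. -/
def next (P : Picture n) : Port P.C P.V n → Port P.C P.V n
  | Sum.inl (c, i) => Sum.inl (c, i + 1)
  | Sum.inr (Sum.inl (v, i)) => Sum.inr (Sum.inl (v, i + 1))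
  | Sum.inr (Sum.inr i) => Sum.inr (Sum.inr i)

/-- The faces of a diagram without boundary points, as orbits of corners. The corner between `p`
and `next p` is denoted by `p`; it is followed, along the left side of the arc leaving through
`p`, by the corner `q` for which `next q` is the other end of that arc. -/
def Face (P : Picture 0) : Type :=
  Quot fun p q : Port P.C P.V 0 => P.next q ≠ p ∧ P.arc (P.next q) = P.arc p

/-- The connected components which contain a crossing or a vertex. -/
def Component (P : Picture 0) : Type :=
  Quot fun p q : Port P.C P.V 0 => q = P.next p ∨ P.arc q = P.arc p

/-- Planarity: Euler's formula `nodes - arcs + faces = 2 * components` (times two), where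
the number of arcs with ends is half the number of ports. -/
def IsPlanar (P : Picture 0) : Prop :=
  2 * (Nat.card P.C + Nat.card P.V) + 2 * Nat.card P.Face =
    Nat.card (Port P.C P.V 0) + 4 * Nat.card P.Component

/-- Exchange of over and under at all crossings. -/
def mirror (P : Picture n) : Picture n where
  C := P.C
  V := P.V
  E := P.E
  finite_C := P.finite_C
  finite_V := P.finite_V
  finite_E := P.finite_E
  arc := fun p => P.arc (Sum.map (Prod.map id (· + 1)) id p)
  ends := by
    have hb : Function.Bijective
        (Sum.map (Prod.map id (· + 1)) id : Port P.C P.V n → Port P.C P.V n) :=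
      Sum.map_bijective.2
        ⟨Function.bijective_id.prodMap (Equiv.addRight (1 : Fin 4)).bijective,
          Function.bijective_id⟩
    intro p
    obtain ⟨q, ⟨hq, hq'⟩, hu⟩ := P.ends (Sum.map (Prod.map id (· + 1)) id p)
    obtain ⟨q, rfl⟩ := hb.2 q
    refine ⟨q, ⟨fun h => hq (by rw [h]), hq'⟩, fun r hr => hb.1 (hu _ ⟨?_, hr.2⟩)⟩
    exact fun h => hr.1 (hb.1 h)

/-- The table of arcs of a diagram with `k` crossings, `l` vertices, `m` arcs and `n` boundary
points. -/
def table {k l m n : ℕ} (cr : Fin k → Fin 4 → Fin m) (ve : Fin l → Fin 3 → Fin m)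
    (bd : Fin n → Fin m) : Port (Fin k) (Fin l) n → Fin m :=
  Sum.elim (fun p => cr p.1 p.2) (Sum.elim (fun p => ve p.1 p.2) bd)

/-- A diagram given by its table of arcs. -/
abbrev ofTable {k l m n : ℕ} (cr : Fin k → Fin 4 → Fin m) (ve : Fin l → Fin 3 → Fin m)
    (bd : Fin n → Fin m)
    (h : ∀ p, ∃ q, (q ≠ p ∧ table cr ve bd q = table cr ve bd p) ∧
      ∀ r, (r ≠ p ∧ table cr ve bd r = table cr ve bd p) → r = q) : Picture n where
  C := Fin k
  V := Fin l
  E := Fin m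
  finite_C := inferInstance
  finite_V := inferInstance
  finite_E := inferInstance
  arc := table cr ve bd
  ends := h

section Moves

set_option synthInstance.maxSize 2000
set_option maxRecDepth 20000

/-- Move I: a strand. -/
def oneL : Picture 2 := ofTable (k := 0) (l := 0) (m := 1) ![] ![] ![0, 0] (by decide)

/-- Move I: a strand with a kink. -/
def oneR : Picture 2 :=
  ofTable (k := 1) (l := 0) (m := 3) ![![0, 0, 1, 2]] ![] ![1, 2] (by decide)

/-- Move II: two strands, one from boundary point `0` (bottom left) to `3` (top left) and one
from `1` (bottom right) to `2` (top right). -/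
def twoL : Picture 4 := ofTable (k := 0) (l := 0) (m := 2) ![] ![] ![0, 1, 1, 0] (by decide)

/-- Move II: the left strand is pushed under the right strand. -/
def twoR : Picture 4 :=
  ofTable (k := 2) (l := 0) (m := 6) ![![0, 1, 2, 3], ![2, 4, 5, 3]] ![] ![0, 1, 4, 5] (by decide)

/-- Move III: three strands from the boundary points `0`, `1`, `2` (bottom left, bottom, bottom
right) to the opposite points `3`, `4`, `5`; the first is the lowest and the third the highest.
The second, vertical strand passes on the left of the crossing of the other two. The
crossings are those of the strands 1 and 3, of 1 and 2, and of 2 and 3. -/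
def threeL : Picture 6 :=
  ofTable (k := 3) (l := 0) (m := 9)
    ![![6, 2, 3, 8], ![0, 1, 6, 7], ![7, 8, 4, 5]] ![] ![0, 1, 2, 3, 4, 5] (by decide)

/-- Move III: the vertical strand passes on the right of the crossing of the other two. -/
def threeR : Picture 6 :=
  ofTable (k := 3) (l := 0) (m := 9)
    ![![0, 8, 6, 5], ![6, 7, 3, 4], ![1, 2, 7, 8]] ![] ![0, 1, 2, 3, 4, 5] (by decide)

/-- Move IV: a vertex. -/
def fourL : Picture 3 :=
  ofTable (k := 0) (l := 1) (m := 3) ![] ![![0, 1, 2]] ![0, 1, 2] (by decide)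

/-- Move IV: a vertex two of whose legs cross each other. -/
def fourR : Picture 3 :=
  ofTable (k := 1) (l := 1) (m := 5) ![![4, 3, 1, 2]] ![![0, 3, 4]] ![0, 1, 2] (by decide)

/-- Move V: a vertex with one leg pointing down to the boundary point `0` and two legs pointing
up to the boundary points `2` and `3`; a strand from `4` (left) to `1` (right) passes over
the leg pointing down. -/
def fiveL : Picture 5 :=
  ofTable (k := 1) (l := 1) (m := 6) ![![0, 1, 5, 4]] ![![5, 2, 3]] ![0, 1, 2, 3, 4] (by decide)

/-- Move V: the strand passes over the two legs pointing up. -/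
def fiveR : Picture 5 :=
  ofTable (k := 2) (l := 1) (m := 8)
    ![![5, 1, 2, 7], ![6, 7, 3, 4]] ![![0, 5, 6]] ![0, 1, 2, 3, 4] (by decide)

/-- Move VI: the boundary points `0` (bottom left), `1` (bottom right) are joined to one vertex,
and `2` (top right), `3` (top left) to another. -/
def sixL : Picture 4 :=
  ofTable (k := 0) (l := 2) (m := 5) ![] ![![0, 1, 4], ![4, 2, 3]] ![0, 1, 2, 3] (by decide)

/-- Move VI: the points `3`, `0` are joined to one vertex and `1`, `2` to another. -/
def sixR : Picture 4 :=
  ofTable (k := 0) (l := 2) (m := 5) ![] ![![3, 0, 4], ![4, 1, 2]] ![0, 1, 2, 3] (by decide)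

end Moves

/-- The local pictures of the handlebody-knot Reidemeister moves, up to rotations of the disk and
up to exchanging over and under. -/
inductive BasicMove : {n : ℕ} → Picture n → Picture n → Prop
  | I : BasicMove oneL oneR
  | II : BasicMove twoL twoR
  | III : BasicMove threeL threeR
  | IV : BasicMove fourL fourR
  | V : BasicMove fiveL fiveR
  | VI : BasicMove sixL sixR

/-- The local pictures of the handlebody-knot Reidemeister moves, up to rotations of the disk. -/
inductive LocalMove : {n : ℕ} → Picture n → Picture n → Prop
  | basic {n : ℕ} {P Q : Picture n} (h : BasicMove P Q) : LocalMove P Q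
  | basic_symm {n : ℕ} {P Q : Picture n} (h : BasicMove P Q) : LocalMove Q P
  | mirror {n : ℕ} {P Q : Picture n} (h : BasicMove P Q) : LocalMove P.mirror Q.mirror
  | mirror_symm {n : ℕ} {P Q : Picture n} (h : BasicMove P Q) : LocalMove Q.mirror P.mirror

end Picture

/-- A `Y`-oriented spatial trivalent graph diagram, given by its planar combinatorial code. Its
semiarcs are the elements of `E`. (The position of the connected components of the diagram
relative to each other is not recorded; colorings do not depend on it.) -/
structure YDiagram extends Picture 0 where
  orient : toPicture.YOrientation
  planar : toPicture.IsPlanar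

/-- The set of `X`-colorings of a `Y`-oriented diagram. -/
def YDiagram.Coloring (Γ : YDiagram) (X : Type u) [PartiallyMultiplicativeBiquandle X] : Type u :=
  {f : Γ.E → X // Γ.orient.IsColoring f}

/-- `Gluing Γ o o'`: the diagram `Γ` is cut by a circle into an oriented outer part `T` and an
oriented inner part `P`. The crossings and vertices of `Γ` are those of `T` and of `P`, with
their ports and directions, and the semiarcs of `Γ` are the classes of arcs of `T` and
`P` under the relation generated by joining, for every `i`, the arcs of `T` and of `P` at the
boundary point `i`. -/
structure Gluing (Γ : YDiagram) {n : ℕ} {T P : Picture n} (o : T.YOrientation)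
    (o' : P.YOrientation) where
  crossing : T.C ⊕ P.C ≃ Γ.C
  vertex : T.V ⊕ P.V ≃ Γ.V
  arc : T.E ⊕ P.E → Γ.E
  arc_surjective : Function.Surjective arc
  arc_eq_iff : ∀ x y, arc x = arc y ↔
    Relation.EqvGen (fun x y => ∃ i, x = Sum.inl (T.arcB i) ∧ y = Sum.inr (P.arcB i)) x y
  arc_crossing_outer : ∀ c i, Γ.arcC (crossing (Sum.inl c)) i = arc (Sum.inl (T.arcC c i))
  arc_crossing_inner : ∀ c i, Γ.arcC (crossing (Sum.inr c)) i = arc (Sum.inr (P.arcC c i))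
  arc_vertex_outer : ∀ v i, Γ.arcV (vertex (Sum.inl v)) i = arc (Sum.inl (T.arcV v i))
  arc_vertex_inner : ∀ v i, Γ.arcV (vertex (Sum.inr v)) i = arc (Sum.inr (P.arcV v i))
  dir_crossing_outer : ∀ c i, Γ.orient.inC (crossing (Sum.inl c)) i = o.inC c i
  dir_crossing_inner : ∀ c i, Γ.orient.inC (crossing (Sum.inr c)) i = o'.inC c i
  dir_vertex_outer : ∀ v i, Γ.orient.inV (vertex (Sum.inl v)) i = o.inV v i
  dir_vertex_inner : ∀ v i, Γ.orient.inV (vertex (Sum.inr v)) i = o'.inV v i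
  dir_boundary : ∀ i, o.inB i ≠ o'.inB i

/-- A handlebody-knot Reidemeister move from `Γ` to `Γ'`: inside a disk, one side of one of the
moves I-VI (with any `Y`-orientation) is replaced by the other side, while the oriented part
`outer` of the diagram outside the disk is kept. As the boundary points of `outer` may be
numbered starting anywhere, the local picture may be rotated. -/
structure HandlebodyMove (Γ Γ' : YDiagram) where
  n : ℕ
  outer : Picture n
  inner : Picture n
  inner' : Picture n
  isMove : Picture.LocalMove inner inner'
  outerOrient : outer.YOrientation
  innerOrient : inner.YOrientation
  innerOrient' : inner'.YOrientation
  source : Gluing Γ outerOrient innerOrient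
  target : Gluing Γ' outerOrient innerOrient'

/-- Two colorings agree outside the neighborhood of a move. -/
def HandlebodyMove.Agree {Γ Γ' : YDiagram} (m : HandlebodyMove Γ Γ') {X : Type u}
    [PartiallyMultiplicativeBiquandle X] (f : Γ.Coloring X) (f' : Γ'.Coloring X) : Prop :=
  ∀ e : m.outer.E, f'.1 (m.target.arc (Sum.inl e)) = f.1 (m.source.arc (Sum.inl e))

/-- The equivalence relation on `Y`-oriented diagrams generated by the handlebody-knot
Reidemeister moves; its classes are the `S¹`-oriented handlebody-knots. -/
def HandlebodyEquiv : YDiagram → YDiagram → Prop :=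
  Relation.EqvGen fun Γ Γ' => Nonempty (HandlebodyMove Γ Γ')

section Crossings

/-!
A coloring of a diagram is determined locally, so it suffices to treat the local pictures of the
moves: for every orientation and every coloring of one side there must be a coloring of the other
side with the same boundary colors, and only one. Read in terms of the colors around a disk, the
existence is an exchange of relations.

For the moves I-III these relations come from the axioms of a biquandle; only one orientation of
move III has to be computed, the others follow by sliding in the opposite direction along a strand
with its orientation reversed. For the moves IV-VI the key is that the elements occurring in
products have inverses, so that a vertex whose edges are directed arbitrarily obeys a cyclically
symmetric rule: the product of the three signed colors is a unit. Reversing an edge amounts to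
inverting its color, which reduces all orientations of a move to a single one.
-/

variable {X : Type u} [Biquandle X]

open Biquandle

theorem under_left_injective {x x' y : X} (h : x ▹ᵤ y = x' ▹ᵤ y) : x = x' :=
  (under_bijective y).1 h

theorem over_left_injective {x x' y : X} (h : x ▹ₒ y = x' ▹ₒ y) : x = x' :=
  (over_bijective y).1 h

theorem switch_injective {x y x' y' : X} (hu : x ▹ᵤ y = x' ▹ᵤ y') (ho : y ▹ₒ x = y' ▹ₒ x') :
    x = x' ∧ y = y' :=
  Prod.mk.inj ((switch_bijective (X := X)).1 (a₁ := (x, y)) (a₂ := (x', y')) (Prod.ext ho hu))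

theorem switch_surjective (x' y' : X) : ∃ x y : X, x ▹ᵤ y = x' ∧ y ▹ₒ x = y' := by
  obtain ⟨⟨x, y⟩, h⟩ := (switch_bijective (X := X)).2 (y', x')
  exact ⟨x, y, (Prod.mk.inj h).2, (Prod.mk.inj h).1⟩

theorem diagonal_injective {x y : X} (h : x ▹ᵤ x = y ▹ᵤ y) : x = y :=
  (switch_injective h (by rw [← under_self, ← under_self, h])).1

theorem eq_of_under_eq_over {x y : X} (h : x ▹ᵤ y = y ▹ₒ x) : x = y := by
  have hx : x ▹ᵤ x = y ▹ₒ x := by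
    refine (under_left_injective (y := y ▹ₒ x) ?_).trans h
    rw [← exchange_uu, h]
  have hy : y ▹ₒ y = x ▹ᵤ y := by
    refine (over_left_injective (y := x ▹ᵤ y) ?_).trans h.symm
    rw [← exchange_oo, ← h]
  exact diagonal_injective (by rw [hx, under_self, hy, h])

theorem diagonal_surjective (a : X) : ∃ x : X, x ▹ᵤ x = a := by
  obtain ⟨x, y, hu, ho⟩ := switch_surjective a a
  obtain rfl := eq_of_under_eq_over (hu.trans ho.symm)
  exact ⟨x, hu⟩

/-- The colors around a crossing: `x`, `y` are the colors of the under- and the over-semiarc around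
the corner to the left of both strands, and `x'`, `y'` are those of the opposite semiarcs. -/
def CrossRel (x y x' y' : X) : Prop := x' = x ▹ᵤ y ∧ y' = y ▹ₒ x

/-- The coloring rule at a crossing, in terms of the colors at its four ports and of the directions
of the strands: `s` and `t` say that the under-strand is directed from port `0` to port `2` and
that the over-strand is directed from port `1` to port `3`. -/
def CrossingRule : Bool → Bool → X → X → X → X → Prop
  | true, true, a, b, c, d => CrossRel a d c b
  | true, false, a, b, c, d => CrossRel c d a b
  | false, true, a, b, c, d => CrossRel a b c d
  | false, false, a, b, c, d => CrossRel c b a d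

namespace CrossingRule

variable {s t : Bool} {a b c d a' b' c' d' : X}

theorem reverse_under : CrossingRule (!s) t a b c d ↔ CrossingRule s t a d c b := by
  cases s <;> cases t <;> rfl

theorem reverse_over : CrossingRule s (!t) a b c d ↔ CrossingRule s t c b a d := by
  cases s <;> cases t <;> rfl

theorem reverse : CrossingRule (!s) (!t) a b c d ↔ CrossingRule s t c d a b :=
  reverse_under.trans reverse_over

theorem exists₀₁ (s t : Bool) (a b : X) : ∃ c d, CrossingRule s t a b c d := by
  cases s <;> cases t
  · obtain ⟨c, rfl⟩ := (under_bijective b).2 a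
    exact ⟨c, _, rfl, rfl⟩
  · exact ⟨_, _, rfl, rfl⟩
  · obtain ⟨c, d, rfl, rfl⟩ := switch_surjective a b
    exact ⟨c, d, rfl, rfl⟩
  · obtain ⟨d, rfl⟩ := (over_bijective a).2 b
    exact ⟨_, d, rfl, rfl⟩

theorem exists₂₃ (s t : Bool) (c d : X) : ∃ a b, CrossingRule s t a b c d :=
  (exists₀₁ (!s) (!t) c d).imp fun _ => Exists.imp fun _ => reverse.1

theorem exists₀₃ (s t : Bool) (a d : X) : ∃ c b, CrossingRule s t a b c d :=
  (exists₀₁ (!s) t a d).imp fun _ => Exists.imp fun _ => reverse_under.1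

theorem unique₀₁ (h : CrossingRule s t a b c d) (h' : CrossingRule s t a' b' c' d')
    (ha : a = a') (hb : b = b') : c = c' ∧ d = d' := by
  subst ha hb
  cases s <;> cases t
  · obtain rfl := under_left_injective (h.1.symm.trans h'.1)
    exact ⟨rfl, h.2.trans h'.2.symm⟩
  · exact ⟨h.1.trans h'.1.symm, h.2.trans h'.2.symm⟩
  · exact switch_injective (h.1.symm.trans h'.1) (h.2.symm.trans h'.2)
  · obtain rfl := over_left_injective (h.2.symm.trans h'.2)
    exact ⟨h.1.trans h'.1.symm, rfl⟩

theorem unique₁₂ (h : CrossingRule s t a b c d) (h' : CrossingRule s t a' b' c' d')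
    (hb : b = b') (hc : c = c') : a = a' ∧ d = d' := by
  rw [← t.not_not, reverse_over] at h h'
  exact h.unique₀₁ h' hc hb

theorem unique₀₃ (h : CrossingRule s t a b c d) (h' : CrossingRule s t a' b' c' d')
    (ha : a = a') (hd : d = d') : c = c' ∧ b = b' := by
  rw [← s.not_not, reverse_under] at h h'
  exact h.unique₀₁ h' ha hd

theorem unique₂₃ (h : CrossingRule s t a b c d) (h' : CrossingRule s t a' b' c' d')
    (hc : c = c') (hd : d = d') : a = a' ∧ b = b' := by
  rw [← s.not_not, ← t.not_not, reverse] at h h'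
  exact h.unique₀₁ h' hc hd

theorem kink_eq (h : CrossingRule s (!s) a a c d) : c = d := by
  cases s
  · exact h.1.trans ((under_self a).trans h.2.symm)
  · exact eq_of_under_eq_over (h.1.symm.trans h.2)

theorem exists_kink (s : Bool) (c : X) : ∃ a, CrossingRule s (!s) a a c c := by
  cases s
  · obtain ⟨a, rfl⟩ := diagonal_surjective c
    exact ⟨a, rfl, under_self a⟩
  · exact ⟨_, rfl, under_self c⟩

end CrossingRule

/-- The passage of the second strand across the crossing of the first and the third one in the
move III, for the strands `1`, `2`, `3` numbered from the lowest to the highest one and colorings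
in `X`. The strand `i` is directed upwards if `sᵢ` holds. The colors `a₀`, ..., `a₅` are those at
the boundary, and the remaining ones belong to the arcs inside the disk. -/
def TripleSlides (X : Type u) [Biquandle X] (s₁ s₂ s₃ : Bool) : Prop :=
  ∀ ⦃a₀ a₁ a₂ a₃ a₄ a₅ a₆ a₇ a₈ : X⦄, CrossingRule s₁ s₂ a₀ a₁ a₆ a₇ →
    CrossingRule s₁ s₃ a₆ a₂ a₃ a₈ → CrossingRule s₂ s₃ a₇ a₈ a₄ a₅ →
    ∃ b₆ b₇ b₈, CrossingRule s₁ s₂ b₆ b₇ a₃ a₄ ∧ CrossingRule s₁ s₃ a₀ b₈ b₆ a₅ ∧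
      CrossingRule s₂ s₃ a₁ a₂ b₇ b₈

namespace TripleSlides

variable {s₁ s₂ s₃ : Bool}

open CrossingRule

theorem true_false_true : TripleSlides X true false true := by
  rintro a₀ a₁ a₂ a₃ a₄ a₅ a₆ a₇ a₈ ⟨rfl, rfl⟩ ⟨rfl, rfl⟩ ⟨rfl, rfl⟩
  exact ⟨_, _, _, ⟨rfl, rfl⟩, ⟨exchange_uu _ _ _, rfl⟩, exchange_uo _ _ _, (exchange_oo _ _ _).symm⟩

-- To reverse a strand, add the crossing of the other two strands on the far side and slide these
-- two strands back across the reversed one. By uniqueness, the given crossing arises.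

theorem reverse₁ (h : TripleSlides X s₁ s₂ s₃) : TripleSlides X (!s₁) s₂ s₃ := by
  intro a₀ a₁ a₂ a₃ a₄ a₅ a₆ a₇ a₈ h₁₂ h₁₃ h₂₃
  obtain ⟨b₇, b₈, k₂₃⟩ := exists₀₁ s₂ s₃ a₁ a₂
  obtain ⟨b₆, c₇, c₈, k₁₂, k₁₃, l₂₃⟩ := h (reverse_under.1 h₁₂) (reverse_under.1 h₁₃) k₂₃
  obtain ⟨rfl, rfl⟩ := h₂₃.unique₀₁ l₂₃ rfl rfl
  exact ⟨b₆, b₇, b₈, reverse_under.2 k₁₂, reverse_under.2 k₁₃, k₂₃⟩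

theorem reverse₂ (h : TripleSlides X s₁ s₂ s₃) : TripleSlides X s₁ (!s₂) s₃ := by
  intro a₀ a₁ a₂ a₃ a₄ a₅ a₆ a₇ a₈ h₁₂ h₁₃ h₂₃
  obtain ⟨b₆, b₈, k₁₃⟩ := exists₀₃ s₁ s₃ a₀ a₅
  obtain ⟨c₆, b₇, c₈, k₁₂, l₁₃, k₂₃⟩ := h (reverse_over.1 h₁₂) k₁₃ (reverse_under.1 h₂₃)
  obtain ⟨rfl, rfl⟩ := h₁₃.unique₀₃ l₁₃ rfl rfl
  exact ⟨b₆, b₇, b₈, reverse_over.2 k₁₂, k₁₃, reverse_under.2 k₂₃⟩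

theorem reverse₃ (h : TripleSlides X s₁ s₂ s₃) : TripleSlides X s₁ s₂ (!s₃) := by
  intro a₀ a₁ a₂ a₃ a₄ a₅ a₆ a₇ a₈ h₁₂ h₁₃ h₂₃
  obtain ⟨b₆, b₇, k₁₂⟩ := exists₂₃ s₁ s₂ a₃ a₄
  obtain ⟨c₆, c₇, b₈, l₁₂, k₁₃, k₂₃⟩ := h k₁₂ (reverse_over.1 h₁₃) (reverse_over.1 h₂₃)
  obtain ⟨rfl, rfl⟩ := h₁₂.unique₂₃ l₁₂ rfl rfl
  exact ⟨b₆, b₇, b₈, k₁₂, reverse_over.2 k₁₃, reverse_over.2 k₂₃⟩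

end TripleSlides

theorem tripleSlides : ∀ s₁ s₂ s₃, TripleSlides X s₁ s₂ s₃ := by
  have h := TripleSlides.true_false_true (X := X)
  rintro (_ | _) (_ | _) (_ | _)
  · exact h.reverse₁.reverse₃
  · exact h.reverse₁
  · exact h.reverse₁.reverse₂.reverse₃
  · exact h.reverse₁.reverse₂
  · exact h.reverse₃
  · exact h
  · exact h.reverse₂.reverse₃
  · exact h.reverse₂

end Crossings

section Products

variable {X : Type u} [PartiallyMultiplicativeBiquandle X] {a b c d e u v x y z w : X}

open Biquandle PartiallyMultiplicativeBiquandle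

namespace IsProd

theorem unique (h : IsProd a b c) (h' : IsProd a b d) : c = d := by
  obtain ⟨_, rfl⟩ := h
  obtain ⟨_, rfl⟩ := h'
  rfl

theorem left_cancel (h : IsProd a x c) (h' : IsProd a y c) : x = y :=
  mul_left_injective a x y h.1 h'.1 (h.2.trans h'.2.symm)

theorem right_cancel (h : IsProd x b c) (h' : IsProd y b c) : x = y :=
  mul_right_injective b x y h.1 h'.1 (h.2.trans h'.2.symm)

theorem swap_iff : IsProd a (b ▹ᵤ a) c ↔ IsProd b (a ▹ₒ b) c := by
  constructor
  · rintro ⟨h, rfl⟩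
    exact ⟨(D_swap a b).1 h, (mul_swap a b _ _).symm⟩
  · rintro ⟨h, rfl⟩
    exact ⟨(D_swap a b).2 h, mul_swap a b _ _⟩

theorem under_iff (x : X) : IsProd (a ▹ᵤ x) (b ▹ᵤ (x ▹ₒ a)) (c ▹ᵤ x) ↔ IsProd a b c := by
  constructor
  · rintro ⟨h, hc⟩
    have h' := (D_under a b x).2 h
    exact ⟨h', under_left_injective ((mul_under a b x h' h).trans hc)⟩
  · rintro ⟨h, rfl⟩
    exact ⟨(D_under a b x).1 h, (mul_under a b x _ _).symm⟩

theorem over_iff (x : X) : IsProd (a ▹ₒ x) (b ▹ₒ (x ▹ᵤ a)) (c ▹ₒ x) ↔ IsProd a b c := by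
  constructor
  · rintro ⟨h, hc⟩
    have h' := (D_over a b x).2 h
    exact ⟨h', over_left_injective ((mul_over a b x h' h).trans hc)⟩
  · rintro ⟨h, rfl⟩
    exact ⟨(D_over a b x).1 h, (mul_over a b x _ _).symm⟩

theorem under_act (h : IsProd a b c) (x : X) : x ▹ᵤ c = x ▹ᵤ a ▹ᵤ b := by
  obtain ⟨h, rfl⟩ := h
  exact under_mul a b x h

theorem over_act (h : IsProd a b c) (x : X) : x ▹ₒ c = x ▹ₒ a ▹ₒ b := by
  obtain ⟨h, rfl⟩ := h
  exact over_mul a b x h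

theorem assoc (h : IsProd a b d) (h' : IsProd d c e) : ∃ p, IsProd b c p ∧ IsProd a p e := by
  obtain ⟨h, rfl⟩ := h
  obtain ⟨h', rfl⟩ := h'
  obtain ⟨k, k'⟩ := (D_assoc a b c).1 ⟨h, h'⟩
  exact ⟨_, ⟨k, rfl⟩, k', (PartiallyMultiplicativeBiquandle.mul_assoc a b c _ _ _ _).symm⟩

theorem assoc_symm (h : IsProd b c d) (h' : IsProd a d e) :
    ∃ p, IsProd a b p ∧ IsProd p c e := by
  obtain ⟨h, rfl⟩ := h
  obtain ⟨h', rfl⟩ := h'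
  obtain ⟨k, k'⟩ := (D_assoc a b c).2 ⟨h, h'⟩
  exact ⟨_, ⟨k, rfl⟩, k', PartiallyMultiplicativeBiquandle.mul_assoc a b c _ _ _ _⟩

theorem exists_of_eq (h : IsProd a b x) (h' : IsProd c d x) :
    ∃ e, IsProd a e c ∧ IsProd e d b := by
  obtain ⟨h, rfl⟩ := h
  obtain ⟨e, k, k', l, l'⟩ := (mul_eq_mul_iff a b c d).1 ⟨h, h'.1, h'.2.symm⟩
  exact ⟨e, ⟨k, l⟩, k', l'⟩

theorem exists_unit (h : IsProd a b c) : ∃ u, IsProd a u a ∧ IsProd u b b :=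
  exists_of_eq h h

theorem unit_of_right (h : IsProd a u a) : IsProd u u u := by
  obtain ⟨p, hp, hap⟩ := h.assoc h
  rwa [← h.left_cancel hap] at hp

theorem unit_of_left (h : IsProd u b b) : IsProd u u u := by
  obtain ⟨p, hp, hpb⟩ := h.assoc_symm h
  rwa [← h.right_cancel hpb] at hp

theorem eq_of_unit_right (hu : IsProd u u u) (h : IsProd a u b) : b = a := by
  obtain ⟨p, hp, hpu⟩ := hu.assoc_symm h
  obtain rfl := h.unique hp
  exact hpu.right_cancel h

theorem unit_under_act (h : IsProd u u u) (x : X) : x ▹ᵤ u = x :=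
  under_left_injective (h.under_act x).symm

theorem unit_over_act (h : IsProd u u u) (x : X) : x ▹ₒ u = x :=
  over_left_injective (h.over_act x).symm

theorem unit_under (h : IsProd u u u) (x : X) : IsProd (u ▹ᵤ x) (u ▹ᵤ x) (u ▹ᵤ x) := by
  have := (under_iff x).2 h
  rwa [h.unit_over_act] at this

theorem unit_over_iff (x : X) : IsProd (u ▹ₒ x) (u ▹ₒ x) (u ▹ₒ x) ↔ IsProd u u u := by
  refine ⟨fun h => ?_, fun h => ?_⟩
  · obtain ⟨t, ht⟩ : ∃ t, t ▹ₒ (x ▹ᵤ u) = u ▹ₒ x := (over_bijective (x ▹ᵤ u)).2 _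
    have ht_unit : IsProd t t t := by
      refine ((over_iff x).1 ?_).unit_of_right (a := u)
      rwa [ht]
    have hut : u ▹ᵤ u = t := over_left_injective <| by
      rw [exchange_uo, h.unit_under_act, ht]
    rwa [diagonal_injective (hut.trans (ht_unit.unit_under_act t).symm)]
  · have := (over_iff x).2 h
    rwa [h.unit_under_act] at this

theorem exists_right_unit (h : IsProd u b b) : ∃ v, IsProd b v b := by
  refine ⟨u ▹ₒ b, swap_iff.1 ?_⟩
  rwa [h.unit_of_left.unit_under_act]

theorem exists_left_unit (h : IsProd b v b) : ∃ u, IsProd u b b := by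
  obtain ⟨u, rfl⟩ := (over_bijective b).2 v
  have hu : IsProd u u u := (unit_over_iff b).1 h.unit_of_right
  have hub : IsProd u (b ▹ᵤ u) b := swap_iff.2 h
  rw [hu.unit_under_act] at hub
  exact ⟨u, hub⟩

end IsProd

/-- The element `a` occurs in some product. This is encoded by a right unit of `a`, which exists
for all factors on the left or on the right and for all products. -/
def IsFactor (a : X) : Prop := ∃ u, IsProd a u a

theorem IsFactor.exists_inv (h : IsFactor a) :
    ∃ e u w, IsProd a u a ∧ IsProd w a a ∧ IsProd a e w ∧ IsProd e a u := by
  obtain ⟨u, hu⟩ := h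
  obtain ⟨w, hw⟩ := hu.exists_left_unit
  obtain ⟨e, hae, hea⟩ := hu.exists_of_eq hw
  exact ⟨e, u, w, hu, hw, hae, hea⟩

open Classical in
/-- The inverse of a factor with respect to the partial multiplication; other elements are their
own inverses by convention. -/
noncomputable def pinv (a : X) : X := if h : IsFactor a then h.exists_inv.choose else a

theorem IsFactor.pinv_spec (h : IsFactor a) :
    ∃ u w, IsProd a u a ∧ IsProd w a a ∧ IsProd a (pinv a) w ∧ IsProd (pinv a) a u := by
  rw [pinv, dif_pos h]
  exact h.exists_inv.choose_spec

theorem pinv_of_not_isFactor (h : ¬ IsFactor a) : pinv a = a := dif_neg h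

namespace IsProd

theorem isFactor_left (h : IsProd a b c) : IsFactor a :=
  h.exists_unit.imp fun _ h => h.1

theorem isFactor_right (h : IsProd a b c) : IsFactor b :=
  h.exists_unit.elim fun _ h => h.2.exists_right_unit

theorem pinv_left (h : IsProd a b c) : IsProd (pinv a) c b := by
  obtain ⟨u, -, hau, -, -, hu⟩ := h.isFactor_left.pinv_spec
  obtain ⟨v, hav, hvb⟩ := h.exists_unit
  obtain rfl := hau.left_cancel hav
  obtain ⟨p, hp, hap⟩ := hu.assoc hvb
  rwa [h.unique hp]

theorem pinv_right (h : IsProd a b c) : IsProd c (pinv b) a := by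
  obtain ⟨-, w, -, hwb, hw, -⟩ := h.isFactor_right.pinv_spec
  obtain ⟨v, hav, hvb⟩ := h.exists_unit
  obtain rfl := hwb.right_cancel hvb
  obtain ⟨p, hp, hpb⟩ := hw.assoc_symm hav
  rwa [h.unique hp]

theorem isFactor (h : IsProd a b c) : IsFactor c := h.pinv_right.isFactor_left

theorem pinv_eq (h : IsProd a b u) (hu : IsProd u u u) : pinv a = b :=
  (eq_of_unit_right hu h.pinv_left).symm

end IsProd

@[simp]
theorem pinv_pinv (a : X) : pinv (pinv a) = a := by
  by_cases h : IsFactor a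
  · obtain ⟨u, -, hau, -, -, hu⟩ := h.pinv_spec
    exact hu.pinv_eq hau.unit_of_right
  · rw [pinv_of_not_isFactor h, pinv_of_not_isFactor h]

theorem IsFactor.pinv (h : IsFactor a) : IsFactor (pinv a) := by
  obtain ⟨_, _, -, -, h, -⟩ := h.pinv_spec
  exact h.isFactor_right

theorem isFactor_under_iff : IsFactor (a ▹ᵤ x) ↔ IsFactor a := by
  refine ⟨fun ⟨u, h⟩ => ?_, fun ⟨_, h⟩ => ⟨_, (IsProd.under_iff x).2 h⟩⟩
  obtain ⟨v, rfl⟩ := (under_bijective (x ▹ₒ a)).2 u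
  exact ⟨v, (IsProd.under_iff x).1 h⟩

theorem isFactor_over_iff : IsFactor (a ▹ₒ x) ↔ IsFactor a := by
  refine ⟨fun ⟨u, h⟩ => ?_, fun ⟨_, h⟩ => ⟨_, (IsProd.over_iff x).2 h⟩⟩
  obtain ⟨v, rfl⟩ := (over_bijective (x ▹ᵤ a)).2 u
  exact ⟨v, (IsProd.over_iff x).1 h⟩

/-- The color of an edge read in the direction given by `b`. -/
noncomputable def signed (b : Bool) (a : X) : X := if b then a else pinv a

@[simp] theorem signed_true (a : X) : signed true a = a := rfl

@[simp] theorem signed_false (a : X) : signed false a = pinv a := rfl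

@[simp] theorem signed_not (b : Bool) (a : X) : signed (!b) a = pinv (signed b a) := by
  cases b <;> simp

theorem signed_involutive (b : Bool) : Function.Involutive (signed b : X → X) := by
  cases b
  exacts [pinv_pinv, fun _ => rfl]

theorem isFactor_signed {b : Bool} : IsFactor (signed b a) ↔ IsFactor a := by
  cases b
  · exact ⟨fun h => by simpa using h.pinv, IsFactor.pinv⟩
  · rfl

namespace CrossRel

variable {x' y' : X}

theorem isFactor_under (h : CrossRel x y x' y') : IsFactor x' ↔ IsFactor x := by
  rw [h.1, isFactor_under_iff]

theorem isFactor_over (h : CrossRel x y x' y') : IsFactor y' ↔ IsFactor y := by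
  rw [h.2, isFactor_over_iff]

theorem pinv_under (h : CrossRel x y x' y') (hx : IsFactor x) :
    CrossRel (pinv x) y' (pinv x') y := by
  obtain ⟨rfl, rfl⟩ := h
  obtain ⟨-, w, -, hwx, hw, -⟩ := hx.pinv_spec
  have hw_unit := hwx.unit_of_left
  refine ⟨((IsProd.under_iff y).2 hw).pinv_eq (hw_unit.unit_under y), ?_⟩
  rw [← hw.over_act, hw_unit.unit_over_act]

theorem pinv_over (h : CrossRel x y x' y') (hy : IsFactor y) :
    CrossRel x' (pinv y) x (pinv y') := by
  obtain ⟨rfl, rfl⟩ := h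
  obtain ⟨-, w, -, hwy, hw, -⟩ := hy.pinv_spec
  have hw_unit := hwy.unit_of_left
  refine ⟨?_, ((IsProd.over_iff x).2 hw).pinv_eq ((IsProd.unit_over_iff x).2 hw_unit)⟩
  rw [← hw.under_act, hw_unit.unit_under_act]

end CrossRel

/-- The coloring rule at a vertex, in terms of the colors at its three ports, where the edges
are read in the direction towards the vertex. -/
def VertexRule (x y z : X) : Prop := IsProd x y (pinv z)

namespace VertexRule

variable {s t : Bool}

theorem merge_iff : VertexRule a b (pinv c) ↔ IsProd a b c := by
  rw [VertexRule, pinv_pinv]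

theorem rotate (h : VertexRule x y z) : VertexRule y z x := by
  simpa only [VertexRule, pinv_pinv] using (IsProd.pinv_left h).pinv_right

theorem rotate_iff : VertexRule x y z ↔ VertexRule y z x :=
  ⟨rotate, fun h => h.rotate.rotate⟩

theorem split_iff : VertexRule x (pinv a) (pinv b) ↔ IsProd b a x := by
  rw [VertexRule, pinv_pinv]
  refine ⟨fun h => ?_, IsProd.pinv_right⟩
  simpa only [pinv_pinv] using IsProd.pinv_right h

theorem signed_split_iff :
    VertexRule x (signed (!s) a) (signed (!t) b) ↔ IsProd (signed t b) (signed s a) x := by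
  rw [signed_not, signed_not, split_iff]

theorem unique (h : VertexRule x y z) (h' : VertexRule x y w) : z = w := by
  rw [← pinv_pinv z, IsProd.unique h h', pinv_pinv]

theorem exchange (h : VertexRule x y e) (h' : VertexRule (pinv e) z w) :
    ∃ f, VertexRule w x f ∧ VertexRule (pinv f) y z := by
  obtain ⟨f, hyz, hxf⟩ := IsProd.assoc h h'
  exact ⟨f, rotate_iff.2 hxf, rotate_iff.2 (merge_iff.2 hyz)⟩

theorem exists_signed_iff (s : Bool) :
    (∃ e, VertexRule x y (signed s e) ∧ VertexRule (signed (!s) e) z w) ↔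
      ∃ e, VertexRule x y e ∧ VertexRule (pinv e) z w := by
  simp only [signed_not]
  exact ((signed_involutive s).surjective.exists
    (p := fun e => VertexRule x y e ∧ VertexRule (pinv e) z w)).symm

theorem signed_exchange_iff (r s : Bool) :
    (∃ e, VertexRule x y (signed r e) ∧ VertexRule (signed (!r) e) z w) ↔
      ∃ f, VertexRule w x (signed s f) ∧ VertexRule (signed (!s) f) y z := by
  rw [exists_signed_iff, exists_signed_iff]
  refine ⟨fun ⟨_, h, h'⟩ => h.exchange h', fun ⟨_, h, h'⟩ => ?_⟩
  obtain ⟨e, hzw, hxy⟩ := h.exchange h'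
  exact ⟨pinv e, hxy.rotate, by rwa [pinv_pinv, rotate_iff]⟩

end VertexRule

namespace CrossingRule

variable {r s t p : Bool}

theorem isFactor_under (h : CrossingRule s t a b c d) : IsFactor c ↔ IsFactor a := by
  cases s <;> cases t
  exacts [h.isFactor_under.symm, h.isFactor_under, h.isFactor_under.symm, h.isFactor_under]

theorem isFactor_over (h : CrossingRule s t a b c d) : IsFactor d ↔ IsFactor b := by
  cases s <;> cases t
  exacts [h.isFactor_over, h.isFactor_over, h.isFactor_over.symm, h.isFactor_over.symm]

theorem pinv_under (h : CrossingRule s t a b c d) (ha : IsFactor a) :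
    CrossingRule (!s) t (pinv a) b (pinv c) d := by
  have hc := h.isFactor_under.2 ha
  cases s <;> cases t
  exacts [CrossRel.pinv_under h hc, CrossRel.pinv_under h ha, CrossRel.pinv_under h hc,
    CrossRel.pinv_under h ha]

theorem pinv_over (h : CrossingRule s t a b c d) (hb : IsFactor b) :
    CrossingRule s (!t) a (pinv b) c (pinv d) := by
  have hd := h.isFactor_over.2 hb
  cases s <;> cases t
  exacts [CrossRel.pinv_over h hb, CrossRel.pinv_over h hb, CrossRel.pinv_over h hd,
    CrossRel.pinv_over h hd]

theorem signed_under_iff (ha : IsFactor a) :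
    CrossingRule true t (signed s a) b (signed s c) d ↔ CrossingRule s t a b c d := by
  cases s
  · refine ⟨fun h => ?_, fun h => h.pinv_under ha⟩
    simpa using h.pinv_under ha.pinv
  · rfl

theorem signed_over_iff (hb : IsFactor b) :
    CrossingRule s true a (signed t b) c (signed t d) ↔ CrossingRule s t a b c d := by
  cases t
  · refine ⟨fun h => ?_, fun h => h.pinv_over hb⟩
    simpa using h.pinv_over hb.pinv
  · rfl

theorem signed_under_iff_of_right (hc : IsFactor c) :
    CrossingRule true t (signed s a) b (signed s c) d ↔ CrossingRule s t a b c d :=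
  reverse_over.symm.trans ((signed_under_iff hc).trans reverse_over)

theorem twist_iff (h : CrossingRule s t a b c d) :
    VertexRule x (signed (!t) b) (signed (!s) a) ↔
      VertexRule x (signed (!s) c) (signed (!t) d) := by
  rw [VertexRule.signed_split_iff, VertexRule.signed_split_iff]
  have iff_of_isFactor (ha : IsFactor a) (hb : IsFactor b) :
      IsProd (signed s a) (signed t b) x ↔ IsProd (signed t d) (signed s c) x := by
    obtain ⟨hc, hb'⟩ := (signed_over_iff hb).2 ((signed_under_iff ha).2 h)
    rw [hc, hb', IsProd.swap_iff]
  refine ⟨fun k => (iff_of_isFactor ?_ ?_).1 k, fun k => (iff_of_isFactor ?_ ?_).2 k⟩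
  · exact isFactor_signed.1 k.isFactor_left
  · exact isFactor_signed.1 k.isFactor_right
  · exact h.isFactor_under.1 (isFactor_signed.1 k.isFactor_right)
  · exact h.isFactor_over.1 (isFactor_signed.1 k.isFactor_left)

theorem pass_isProd_iff : (∃ d, CrossingRule true t x y d w ∧ IsProd a b d) ↔
    ∃ a' b' z, (CrossingRule true t b' y b z ∧ CrossingRule true t a' z a w) ∧
      IsProd a' b' x := by
  cases t
  · constructor
    · rintro ⟨d, ⟨rfl, rfl⟩, h⟩
      exact ⟨_, _, _, ⟨⟨rfl, h.over_act w⟩, rfl, rfl⟩, (IsProd.under_iff w).2 h⟩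
    · rintro ⟨_, _, _, ⟨⟨rfl, rfl⟩, rfl, rfl⟩, h⟩
      obtain ⟨d, rfl⟩ := (under_bijective w).2 x
      rw [IsProd.under_iff] at h
      exact ⟨d, ⟨rfl, (h.over_act w).symm⟩, h⟩
  · constructor
    · rintro ⟨_, ⟨rfl, rfl⟩, h⟩
      obtain ⟨a', rfl⟩ := (under_bijective w).2 a
      obtain ⟨b', rfl⟩ := (under_bijective (w ▹ₒ a')).2 b
      rw [IsProd.under_iff] at h
      exact ⟨a', b', _, ⟨⟨rfl, h.over_act w⟩, rfl, rfl⟩, h⟩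
    · rintro ⟨a', b', _, ⟨⟨rfl, rfl⟩, rfl, rfl⟩, h⟩
      exact ⟨_, ⟨rfl, (h.over_act w).symm⟩, (IsProd.under_iff w).2 h⟩

theorem pass_iff :
    (∃ d, CrossingRule r t x y d w ∧ VertexRule (signed r d) (signed (!s) b) (signed (!p) a)) ↔
      ∃ a' b' z, (CrossingRule s t b' y b z ∧ CrossingRule p t a' z a w) ∧
        VertexRule (signed r x) (signed (!s) b') (signed (!p) a') := by
  simp only [VertexRule.signed_split_iff]
  calc
    _ ↔ ∃ d, CrossingRule true t (signed r x) y (signed r d) w ∧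
          IsProd (signed p a) (signed s b) (signed r d) :=
      exists_congr fun d => and_congr_left fun h =>
        (signed_under_iff_of_right (isFactor_signed.1 h.isFactor)).symm
    _ ↔ ∃ d, CrossingRule true t (signed r x) y d w ∧ IsProd (signed p a) (signed s b) d :=
      ((signed_involutive r).surjective.exists
        (p := fun d => CrossingRule true t (signed r x) y d w ∧ IsProd _ _ d)).symm
    _ ↔ ∃ a' b' z, (CrossingRule true t b' y (signed s b) z ∧
          CrossingRule true t a' z (signed p a) w) ∧ IsProd a' b' (signed r x) := pass_isProd_iff
    _ ↔ ∃ a' b' z, (CrossingRule true t (signed s b') y (signed s b) z ∧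
          CrossingRule true t (signed p a') z (signed p a) w) ∧
          IsProd (signed p a') (signed s b') (signed r x) :=
      (signed_involutive p).surjective.exists.trans <| exists_congr fun _ =>
        (signed_involutive s).surjective.exists
    _ ↔ _ := exists_congr fun a' => exists_congr fun b' => exists_congr fun z =>
      and_congr_left fun h => and_congr
        (signed_under_iff (isFactor_signed.1 h.isFactor_right))
        (signed_under_iff (isFactor_signed.1 h.isFactor_left))

end CrossingRule

end Products

namespace Picture

variable {n : ℕ} {P Q : Picture n} {X : Type u} [PartiallyMultiplicativeBiquandle X]

theorem exists_odd_port : ∀ b : Fin 3 → Bool, (∃ i, b i = true) → (∃ i, b i = false) →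
    ∃ i, b (i + 1) = !b i ∧ b (i + 2) = !b i := by
  decide

theorem vertexRule_rotate_iff (a : Fin 3 → X) (i : Fin 3) :
    VertexRule (a (i + 1)) (a (i + 2)) (a i) ↔ VertexRule (a 0) (a 1) (a 2) := by
  fin_cases i
  · exact VertexRule.rotate_iff.symm
  · exact VertexRule.rotate_iff
  · exact Iff.rfl

namespace YOrientation

theorem inC_add_two (o : P.YOrientation) (c : P.C) (i : Fin 4) :
    o.inC c (i + 2) = !o.inC c i :=
  Bool.eq_not.2 (o.crossing_dir c i).symm

theorem inward_eq_not (o : P.YOrientation) {p q : Port P.C P.V n} (h : p ≠ q)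
    (h' : P.arc p = P.arc q) : o.inward p = !o.inward q :=
  Bool.eq_not.2 (o.arc_dir p q h h')

theorem inC_eq_not_inB (o : P.YOrientation) {c : P.C} {i : Fin 4} {j : Fin n}
    (h : P.arcC c i = P.arcB j) : o.inC c i = !o.inB j :=
  o.inward_eq_not (by nofun) h

theorem inC_eq_inB (o : P.YOrientation) {c : P.C} {i : Fin 4} {j : Fin n}
    (h : P.arcC c (i + 2) = P.arcB j) : o.inC c i = o.inB j :=
  Bool.not_inj ((o.inC_add_two c i).symm.trans (o.inC_eq_not_inB h))

theorem inC_eq_inC (o : P.YOrientation) {c d : P.C} {i j : Fin 4} (hne : (c, i) ≠ (d, j + 2))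
    (h : P.arcC c i = P.arcC d (j + 2)) : o.inC c i = o.inC d j :=
  (o.inward_eq_not (Sum.inl_injective.ne hne) h).trans
    (Bool.not_eq_eq_eq_not.2 (o.inC_add_two d j))

theorem inV_eq_not_inB (o : P.YOrientation) {v : P.V} {i : Fin 3} {j : Fin n}
    (h : P.arcV v i = P.arcB j) : o.inV v i = !o.inB j :=
  o.inward_eq_not (by nofun) h

theorem inV_eq_inC (o : P.YOrientation) {v : P.V} {i : Fin 3} {c : P.C} {j : Fin 4}
    (h : P.arcV v i = P.arcC c (j + 2)) : o.inV v i = o.inC c j :=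
  (o.inward_eq_not (by nofun) h).trans (Bool.not_eq_eq_eq_not.2 (o.inC_add_two c j))

theorem isColoring_iff_crossingRule (o : P.YOrientation) (f : P.E → X) : o.IsColoring f ↔
    (∀ c, CrossingRule (o.inC c 0) (o.inC c 1) (f (P.arcC c 0)) (f (P.arcC c 1)) (f (P.arcC c 2))
      (f (P.arcC c 3))) ∧
    (∀ v i, o.inV v (i + 1) = true → o.inV v (i + 2) = true → o.inV v i = false →
      IsProd (f (P.arcV v (i + 1))) (f (P.arcV v (i + 2))) (f (P.arcV v i))) ∧
    ∀ v i, o.inV v (i + 1) = false → o.inV v (i + 2) = false → o.inV v i = true →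
      IsProd (f (P.arcV v (i + 2))) (f (P.arcV v (i + 1))) (f (P.arcV v i)) := by
  have rule_iff (c : P.C) : CrossingRule (o.inC c 0) (o.inC c 1) (f (P.arcC c 0))
      (f (P.arcC c 1)) (f (P.arcC c 2)) (f (P.arcC c 3)) ↔
      f (P.arcC c (o.leftUnder c + 2)) =
          f (P.arcC c (o.leftUnder c)) ▹ᵤ f (P.arcC c (o.leftOver c)) ∧
        f (P.arcC c (o.leftOver c + 2)) =
          f (P.arcC c (o.leftOver c)) ▹ₒ f (P.arcC c (o.leftUnder c)) := by
    unfold leftUnder leftOver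
    cases o.inC c 0 <;> cases o.inC c 1 <;> exact Iff.rfl
  simp only [rule_iff, forall_and, and_assoc]
  exact ⟨fun h => ⟨h.under_rule, h.over_rule, h.merge, h.split⟩,
    fun h => ⟨h.1, h.2.1, h.2.2.1, h.2.2.2⟩⟩

theorem vertexRule_iff (o : P.YOrientation) (f : P.E → X) (v : P.V) :
    VertexRule (signed (o.inV v 0) (f (P.arcV v 0))) (signed (o.inV v 1) (f (P.arcV v 1)))
        (signed (o.inV v 2) (f (P.arcV v 2))) ↔
      (∀ i, o.inV v (i + 1) = true → o.inV v (i + 2) = true → o.inV v i = false →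
        IsProd (f (P.arcV v (i + 1))) (f (P.arcV v (i + 2))) (f (P.arcV v i))) ∧
      ∀ i, o.inV v (i + 1) = false → o.inV v (i + 2) = false → o.inV v i = true →
        IsProd (f (P.arcV v (i + 2))) (f (P.arcV v (i + 1))) (f (P.arcV v i)) := by
  have rule_iff (i : Fin 3) :=
    vertexRule_rotate_iff (fun j => signed (o.inV v j) (f (P.arcV v j))) i
  constructor
  · refine fun h => ⟨fun i h₁ h₂ h₀ => ?_, fun i h₁ h₂ h₀ => ?_⟩
    all_goals
      have h := (rule_iff i).2 h
      simp only [h₀, h₁, h₂, signed_true, signed_false] at h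
    exacts [VertexRule.merge_iff.1 h, VertexRule.split_iff.1 h.rotate.rotate]
  · rintro ⟨merge, split⟩
    obtain ⟨i, h₁, h₂⟩ := exists_odd_port (o.inV v) (o.vertex_dir v).1 (o.vertex_dir v).2
    rw [← rule_iff i]
    simp only [h₁, h₂]
    cases h₀ : o.inV v i
    · exact VertexRule.merge_iff.2 (merge i (by simp [h₁, h₀]) (by simp [h₂, h₀]) h₀)
    · exact (VertexRule.split_iff.2 (split i (by simp [h₁, h₀]) (by simp [h₂, h₀]) h₀)).rotate

theorem isColoring_iff (o : P.YOrientation) (f : P.E → X) : o.IsColoring f ↔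
    (∀ c, CrossingRule (o.inC c 0) (o.inC c 1) (f (P.arcC c 0)) (f (P.arcC c 1)) (f (P.arcC c 2))
      (f (P.arcC c 3))) ∧
    ∀ v, VertexRule (signed (o.inV v 0) (f (P.arcV v 0))) (signed (o.inV v 1) (f (P.arcV v 1)))
      (signed (o.inV v 2) (f (P.arcV v 2))) := by
  simp only [isColoring_iff_crossingRule, vertexRule_iff, forall_and]

end YOrientation

theorem crossingRule_congr {s t s' t' : Bool} (hs : s = s') (ht : t = t') {a b c d : X} :
    CrossingRule s t a b c d ↔ CrossingRule s' t' a b c d := by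
  rw [hs, ht]

theorem vertexRule_congr {r s t r' s' t' : Bool} (hr : r = r') (hs : s = s') (ht : t = t')
    {a b c : X} : VertexRule (signed r a) (signed s b) (signed t c) ↔
      VertexRule (signed r' a) (signed s' b) (signed t' c) := by
  rw [hr, hs, ht]

theorem forall_fin_three {p : Fin 3 → Prop} : (∀ i, p i) ↔ p 0 ∧ p 1 ∧ p 2 := by
  simp only [Fin.forall_fin_succ, Fin.succ_zero_eq_one, Fin.succ_one_eq_two, IsEmpty.forall_iff,
    and_true]

theorem oneL_isColoring (o : oneL.YOrientation) (f : Fin 1 → X) : o.IsColoring f :=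
  (o.isColoring_iff f).2 ⟨by nofun, by nofun⟩

theorem oneR_isColoring_iff (o : oneR.YOrientation) (f : Fin 3 → X) : o.IsColoring f ↔
    CrossingRule (o.inB 0) (!o.inB 0) (f 0) (f 0) (f 1) (f 2) := by
  have h₀ : o.inC (0 : Fin 1) 0 = o.inB 0 := o.inC_eq_inB rfl
  have h₁ : o.inC (0 : Fin 1) 1 = !o.inC (0 : Fin 1) 0 := o.inward_eq_not
    (by decide : (Sum.inl (0, 1) : Port (Fin 1) (Fin 0) 2) ≠ Sum.inl (0, 0)) rfl
  exact (o.isColoring_iff f).trans <| (and_iff_left (by nofun)).trans <|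
    Fin.forall_fin_one.trans (crossingRule_congr h₀ (h₁.trans (congrArg _ h₀)))

theorem twoL_isColoring (o : twoL.YOrientation) (f : Fin 2 → X) : o.IsColoring f :=
  (o.isColoring_iff f).2 ⟨by nofun, by nofun⟩

theorem twoR_isColoring_iff (o : twoR.YOrientation) (f : Fin 6 → X) : o.IsColoring f ↔
    CrossingRule (!o.inB 0) (!o.inB 1) (f 0) (f 1) (f 2) (f 3) ∧
    CrossingRule (!o.inB 0) (o.inB 1) (f 2) (f 4) (f 5) (f 3) := by
  have h₀ : o.inC (0 : Fin 2) 0 = !o.inB 0 := o.inC_eq_not_inB rfl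
  have h₁ : o.inC (0 : Fin 2) 1 = !o.inB 1 := o.inC_eq_not_inB rfl
  have h₂ : o.inC (1 : Fin 2) 0 = o.inC (0 : Fin 2) 0 := o.inC_eq_inC (by nofun) rfl
  have h₃ : o.inC (1 : Fin 2) 3 = o.inC (0 : Fin 2) 1 := o.inC_eq_inC (by nofun) rfl
  have h₄ : o.inC (1 : Fin 2) 1 = o.inB 1 :=
    (o.inC_add_two _ 3).trans (Bool.not_eq_eq_eq_not.2 (h₃.trans h₁))
  exact (o.isColoring_iff f).trans <| (and_iff_left (by nofun)).trans <|
    Fin.forall_fin_two.trans <|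
    and_congr (crossingRule_congr h₀ h₁) (crossingRule_congr (h₂.trans h₀) h₄)

theorem threeL_isColoring_iff (o : threeL.YOrientation) (f : Fin 9 → X) : o.IsColoring f ↔
    CrossingRule (!o.inB 0) (!o.inB 2) (f 6) (f 2) (f 3) (f 8) ∧
    CrossingRule (!o.inB 0) (!o.inB 1) (f 0) (f 1) (f 6) (f 7) ∧
    CrossingRule (!o.inB 1) (!o.inB 2) (f 7) (f 8) (f 4) (f 5) := by
  have h₁ : o.inC (1 : Fin 3) 0 = !o.inB 0 := o.inC_eq_not_inB rfl
  have h₂ : o.inC (1 : Fin 3) 1 = !o.inB 1 := o.inC_eq_not_inB rfl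
  have h₃ : o.inC (0 : Fin 3) 1 = !o.inB 2 := o.inC_eq_not_inB rfl
  have h₁' : o.inC (0 : Fin 3) 0 = o.inC (1 : Fin 3) 0 := o.inC_eq_inC (by nofun) rfl
  have h₂' : o.inC (2 : Fin 3) 0 = o.inC (1 : Fin 3) 1 := o.inC_eq_inC (by nofun) rfl
  have h₃' : o.inC (2 : Fin 3) 1 = o.inC (0 : Fin 3) 1 := o.inC_eq_inC (by nofun) rfl
  exact (o.isColoring_iff f).trans <| (and_iff_left (by nofun)).trans <|
    forall_fin_three.trans <| and_congr (crossingRule_congr (h₁'.trans h₁) h₃) <|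
    and_congr (crossingRule_congr h₁ h₂) (crossingRule_congr (h₂'.trans h₂) (h₃'.trans h₃))

theorem threeR_isColoring_iff (o : threeR.YOrientation) (f : Fin 9 → X) : o.IsColoring f ↔
    CrossingRule (!o.inB 0) (!o.inB 2) (f 0) (f 8) (f 6) (f 5) ∧
    CrossingRule (!o.inB 0) (!o.inB 1) (f 6) (f 7) (f 3) (f 4) ∧
    CrossingRule (!o.inB 1) (!o.inB 2) (f 1) (f 2) (f 7) (f 8) := by
  have h₁ : o.inC (0 : Fin 3) 0 = !o.inB 0 := o.inC_eq_not_inB rfl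
  have h₂ : o.inC (2 : Fin 3) 0 = !o.inB 1 := o.inC_eq_not_inB rfl
  have h₃ : o.inC (2 : Fin 3) 1 = !o.inB 2 := o.inC_eq_not_inB rfl
  have h₁' : o.inC (1 : Fin 3) 0 = o.inC (0 : Fin 3) 0 := o.inC_eq_inC (by nofun) rfl
  have h₂' : o.inC (1 : Fin 3) 1 = o.inC (2 : Fin 3) 0 := o.inC_eq_inC (by nofun) rfl
  have h₃' : o.inC (0 : Fin 3) 1 = o.inC (2 : Fin 3) 1 := o.inC_eq_inC (by nofun) rfl
  exact (o.isColoring_iff f).trans <| (and_iff_left (by nofun)).trans <|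
    forall_fin_three.trans <| and_congr (crossingRule_congr h₁ (h₃'.trans h₃)) <|
    and_congr (crossingRule_congr (h₁'.trans h₁) (h₂'.trans h₂)) (crossingRule_congr h₂ h₃)

theorem fourL_isColoring_iff (o : fourL.YOrientation) (f : Fin 3 → X) : o.IsColoring f ↔
    VertexRule (signed (!o.inB 0) (f 0)) (signed (!o.inB 1) (f 1)) (signed (!o.inB 2) (f 2)) := by
  have h₀ : o.inV (0 : Fin 1) 0 = !o.inB 0 := o.inV_eq_not_inB rfl
  have h₁ : o.inV (0 : Fin 1) 1 = !o.inB 1 := o.inV_eq_not_inB rfl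
  have h₂ : o.inV (0 : Fin 1) 2 = !o.inB 2 := o.inV_eq_not_inB rfl
  exact (o.isColoring_iff f).trans <| (and_iff_right (by nofun)).trans <|
    Fin.forall_fin_one.trans (vertexRule_congr h₀ h₁ h₂)

theorem fourR_isColoring_iff (o : fourR.YOrientation) (f : Fin 5 → X) : o.IsColoring f ↔
    CrossingRule (o.inB 1) (o.inB 2) (f 4) (f 3) (f 1) (f 2) ∧
    VertexRule (signed (!o.inB 0) (f 0)) (signed (!o.inB 2) (f 3)) (signed (!o.inB 1) (f 4)) := by
  have h₁ : o.inC (0 : Fin 1) 0 = o.inB 1 := o.inC_eq_inB rfl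
  have h₂ : o.inC (0 : Fin 1) 1 = o.inB 2 := o.inC_eq_inB rfl
  have v₀ : o.inV (0 : Fin 1) 0 = !o.inB 0 := o.inV_eq_not_inB rfl
  have v₁ : o.inV (0 : Fin 1) 1 = !o.inB 2 :=
    (o.inV_eq_inC (c := (0 : Fin 1)) (j := 3) rfl).trans (o.inC_eq_not_inB rfl)
  have v₂ : o.inV (0 : Fin 1) 2 = !o.inB 1 :=
    (o.inV_eq_inC (c := (0 : Fin 1)) (j := 2) rfl).trans (o.inC_eq_not_inB rfl)
  exact (o.isColoring_iff f).trans <| and_congr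
    (Fin.forall_fin_one.trans (crossingRule_congr h₁ h₂))
    (Fin.forall_fin_one.trans (vertexRule_congr v₀ v₁ v₂))

theorem fiveL_isColoring_iff (o : fiveL.YOrientation) (f : Fin 6 → X) : o.IsColoring f ↔
    CrossingRule (!o.inB 0) (!o.inB 1) (f 0) (f 1) (f 5) (f 4) ∧
    VertexRule (signed (!o.inB 0) (f 5)) (signed (!o.inB 2) (f 2)) (signed (!o.inB 3) (f 3)) := by
  have h₀ : o.inC (0 : Fin 1) 0 = !o.inB 0 := o.inC_eq_not_inB rfl
  have h₁ : o.inC (0 : Fin 1) 1 = !o.inB 1 := o.inC_eq_not_inB rfl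
  have v₀ : o.inV (0 : Fin 1) 0 = o.inC (0 : Fin 1) 0 := o.inV_eq_inC rfl
  have v₁ : o.inV (0 : Fin 1) 1 = !o.inB 2 := o.inV_eq_not_inB rfl
  have v₂ : o.inV (0 : Fin 1) 2 = !o.inB 3 := o.inV_eq_not_inB rfl
  exact (o.isColoring_iff f).trans <| and_congr
    (Fin.forall_fin_one.trans (crossingRule_congr h₀ h₁))
    (Fin.forall_fin_one.trans (vertexRule_congr (v₀.trans h₀) v₁ v₂))

theorem fiveR_isColoring_iff (o : fiveR.YOrientation) (f : Fin 8 → X) : o.IsColoring f ↔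
    (CrossingRule (o.inB 2) (!o.inB 1) (f 5) (f 1) (f 2) (f 7) ∧
      CrossingRule (o.inB 3) (!o.inB 1) (f 6) (f 7) (f 3) (f 4)) ∧
    VertexRule (signed (!o.inB 0) (f 0)) (signed (!o.inB 2) (f 5)) (signed (!o.inB 3) (f 6)) := by
  have h₂ : o.inC (0 : Fin 2) 0 = o.inB 2 := o.inC_eq_inB rfl
  have h₁ : o.inC (0 : Fin 2) 1 = !o.inB 1 := o.inC_eq_not_inB rfl
  have h₃ : o.inC (1 : Fin 2) 0 = o.inB 3 := o.inC_eq_inB rfl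
  have h₁' : o.inC (1 : Fin 2) 1 = o.inC (0 : Fin 2) 1 := o.inC_eq_inC (by nofun) rfl
  have v₀ : o.inV (0 : Fin 1) 0 = !o.inB 0 := o.inV_eq_not_inB rfl
  have v₁ : o.inV (0 : Fin 1) 1 = !o.inB 2 :=
    (o.inV_eq_inC (c := (0 : Fin 2)) (j := 2) rfl).trans (o.inC_eq_not_inB rfl)
  have v₂ : o.inV (0 : Fin 1) 2 = !o.inB 3 :=
    (o.inV_eq_inC (c := (1 : Fin 2)) (j := 2) rfl).trans (o.inC_eq_not_inB rfl)
  exact (o.isColoring_iff f).trans <| and_congr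
    (Fin.forall_fin_two.trans <| and_congr (crossingRule_congr h₂ h₁)
      (crossingRule_congr h₃ (h₁'.trans h₁)))
    (Fin.forall_fin_one.trans (vertexRule_congr v₀ v₁ v₂))

theorem sixL_isColoring_iff (o : sixL.YOrientation) (f : Fin 5 → X) : o.IsColoring f ↔
    VertexRule (signed (!o.inB 0) (f 0)) (signed (!o.inB 1) (f 1))
      (signed (o.inV (0 : Fin 2) 2) (f 4)) ∧
    VertexRule (signed (!o.inV (0 : Fin 2) 2) (f 4)) (signed (!o.inB 2) (f 2))
      (signed (!o.inB 3) (f 3)) := by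
  have h₀ : o.inV (0 : Fin 2) 0 = !o.inB 0 := o.inV_eq_not_inB rfl
  have h₁ : o.inV (0 : Fin 2) 1 = !o.inB 1 := o.inV_eq_not_inB rfl
  have h₂ : o.inV (1 : Fin 2) 1 = !o.inB 2 := o.inV_eq_not_inB rfl
  have h₃ : o.inV (1 : Fin 2) 2 = !o.inB 3 := o.inV_eq_not_inB rfl
  have h₄ : o.inV (1 : Fin 2) 0 = !o.inV (0 : Fin 2) 2 := o.inward_eq_not (by nofun) rfl
  exact (o.isColoring_iff f).trans <| (and_iff_right (by nofun)).trans <|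
    Fin.forall_fin_two.trans <| and_congr (vertexRule_congr h₀ h₁ rfl) (vertexRule_congr h₄ h₂ h₃)

theorem sixR_isColoring_iff (o : sixR.YOrientation) (f : Fin 5 → X) : o.IsColoring f ↔
    VertexRule (signed (!o.inB 3) (f 3)) (signed (!o.inB 0) (f 0))
      (signed (o.inV (0 : Fin 2) 2) (f 4)) ∧
    VertexRule (signed (!o.inV (0 : Fin 2) 2) (f 4)) (signed (!o.inB 1) (f 1))
      (signed (!o.inB 2) (f 2)) := by
  have h₀ : o.inV (0 : Fin 2) 1 = !o.inB 0 := o.inV_eq_not_inB rfl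
  have h₁ : o.inV (1 : Fin 2) 1 = !o.inB 1 := o.inV_eq_not_inB rfl
  have h₂ : o.inV (1 : Fin 2) 2 = !o.inB 2 := o.inV_eq_not_inB rfl
  have h₃ : o.inV (0 : Fin 2) 0 = !o.inB 3 := o.inV_eq_not_inB rfl
  have h₄ : o.inV (1 : Fin 2) 0 = !o.inV (0 : Fin 2) 2 := o.inward_eq_not (by nofun) rfl
  exact (o.isColoring_iff f).trans <| (and_iff_right (by nofun)).trans <|
    Fin.forall_fin_two.trans <| and_congr (vertexRule_congr h₃ h₀ rfl) (vertexRule_congr h₄ h₁ h₂)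

/-- Every coloring of `P` can be replaced by a coloring of `Q` with the same boundary colors, for
all orientations of `P` and `Q` which agree on the boundary. -/
def Transfers (P Q : Picture n) (X : Type u) [PartiallyMultiplicativeBiquandle X] : Prop :=
  ∀ (o : P.YOrientation) (o' : Q.YOrientation), (∀ i, o.inB i = o'.inB i) →
    ∀ f : P.E → X, o.IsColoring f →
      ∃ g : Q.E → X, o'.IsColoring g ∧ ∀ i, g (Q.arcB i) = f (P.arcB i)

/-- The colorings of `P` are determined by their boundary colors, for every orientation of `P`. -/
def Rigid (P : Picture n) (X : Type u) [PartiallyMultiplicativeBiquandle X] : Prop :=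
  ∀ (o : P.YOrientation) (f g : P.E → X), o.IsColoring f → o.IsColoring g →
    (∀ i, f (P.arcB i) = g (P.arcB i)) → f = g

/-- The two sides of a local move which induces a bijection between `X`-colorings. -/
structure Interchangeable (P Q : Picture n) (X : Type u) [PartiallyMultiplicativeBiquandle X] :
    Prop where
  transfers : Transfers P Q X
  transfers_symm : Transfers Q P X
  rigid_left : Rigid P X
  rigid_right : Rigid Q X

section BasicMoves

open CrossingRule

theorem rigid_oneL : Rigid oneL X :=
  fun _ _ _ _ _ h => funext (Fin.forall_fin_one.2 (h (0 : Fin 2)))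

theorem rigid_oneR : Rigid oneR X := by
  intro o f g hf hg h
  replace hf := (oneR_isColoring_iff o f).1 hf
  replace hg := (oneR_isColoring_iff o g).1 hg
  have h₁ : f (1 : Fin 3) = g (1 : Fin 3) := h (0 : Fin 2)
  have h₂ : f (2 : Fin 3) = g (2 : Fin 3) := h (1 : Fin 2)
  exact funext (forall_fin_three.2 ⟨(hf.unique₂₃ hg h₁ h₂).1, h₁, h₂⟩)

theorem transfers_oneL_oneR : Transfers oneL oneR X := by
  intro o o' _ f _
  obtain ⟨a, ha⟩ := exists_kink (o'.inB 0) (f (0 : Fin 1))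
  exact ⟨(![a, f (0 : Fin 1), f (0 : Fin 1)] : Fin 3 → X), (oneR_isColoring_iff o' _).2 ha,
    Fin.forall_fin_two.2 ⟨rfl, rfl⟩⟩

theorem transfers_oneR_oneL : Transfers oneR oneL X := by
  intro o o' _ f hf
  have h₁₂ : f (1 : Fin 3) = f (2 : Fin 3) := kink_eq ((oneR_isColoring_iff o f).1 hf)
  exact ⟨fun _ => f (1 : Fin 3), oneL_isColoring o' _, Fin.forall_fin_two.2 ⟨rfl, h₁₂⟩⟩

theorem interchangeable_one : Interchangeable oneL oneR X :=
  ⟨transfers_oneL_oneR, transfers_oneR_oneL, rigid_oneL, rigid_oneR⟩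

theorem rigid_twoL : Rigid twoL X :=
  fun _ _ _ _ _ h => funext (Fin.forall_fin_two.2 ⟨h (0 : Fin 4), h (1 : Fin 4)⟩)

theorem rigid_twoR : Rigid twoR X := by
  intro o f g hf hg h
  obtain ⟨hf, -⟩ := (twoR_isColoring_iff o f).1 hf
  obtain ⟨hg, -⟩ := (twoR_isColoring_iff o g).1 hg
  obtain ⟨h₂, h₃⟩ := hf.unique₀₁ hg (h (0 : Fin 4)) (h (1 : Fin 4))
  funext i
  change Fin 6 at i
  fin_cases i
  exacts [h (0 : Fin 4), h (1 : Fin 4), h₂, h₃, h (2 : Fin 4), h (3 : Fin 4)]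

theorem transfers_twoL_twoR : Transfers twoL twoR X := by
  intro o o' _ f _
  obtain ⟨c, d, h⟩ := exists₀₁ (!o'.inB 0) (!o'.inB 1) (f (0 : Fin 2)) (f (1 : Fin 2))
  refine ⟨(![f (0 : Fin 2), f (1 : Fin 2), c, d, f (1 : Fin 2), f (0 : Fin 2)] : Fin 6 → X),
    (twoR_isColoring_iff o' _).2 ⟨h, reverse_over.1 h⟩, fun i => ?_⟩
  change Fin 4 at i
  fin_cases i <;> rfl

theorem transfers_twoR_twoL : Transfers twoR twoL X := by
  intro o o' _ f hf
  obtain ⟨h, h'⟩ := (twoR_isColoring_iff o f).1 hf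
  obtain ⟨h₁, h₂⟩ := (reverse_over.2 h').unique₂₃ h rfl rfl
  refine ⟨(![f (0 : Fin 6), f (1 : Fin 6)] : Fin 2 → X), twoL_isColoring o' _, fun i => ?_⟩
  change Fin 4 at i
  fin_cases i
  exacts [rfl, rfl, h₂.symm, h₁.symm]

theorem interchangeable_two : Interchangeable twoL twoR X :=
  ⟨transfers_twoL_twoR, transfers_twoR_twoL, rigid_twoL, rigid_twoR⟩

theorem rigid_threeL : Rigid threeL X := by
  intro o f g hf hg h
  obtain ⟨hf, -, hf'⟩ := (threeL_isColoring_iff o f).1 hf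
  obtain ⟨hg, -, hg'⟩ := (threeL_isColoring_iff o g).1 hg
  obtain ⟨h₇, h₈⟩ := hf'.unique₂₃ hg' (h (4 : Fin 6)) (h (5 : Fin 6))
  obtain ⟨h₆, -⟩ := hf.unique₁₂ hg (h (2 : Fin 6)) (h (3 : Fin 6))
  funext i
  change Fin 9 at i
  fin_cases i
  exacts [h (0 : Fin 6), h (1 : Fin 6), h (2 : Fin 6), h (3 : Fin 6), h (4 : Fin 6),
    h (5 : Fin 6), h₆, h₇, h₈]

theorem rigid_threeR : Rigid threeR X := by
  intro o f g hf hg h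
  obtain ⟨-, hf, hf'⟩ := (threeR_isColoring_iff o f).1 hf
  obtain ⟨-, hg, hg'⟩ := (threeR_isColoring_iff o g).1 hg
  obtain ⟨h₇, h₈⟩ := hf'.unique₀₁ hg' (h (1 : Fin 6)) (h (2 : Fin 6))
  obtain ⟨h₆, -⟩ := hf.unique₂₃ hg (h (3 : Fin 6)) (h (4 : Fin 6))
  funext i
  change Fin 9 at i
  fin_cases i
  exacts [h (0 : Fin 6), h (1 : Fin 6), h (2 : Fin 6), h (3 : Fin 6), h (4 : Fin 6),
    h (5 : Fin 6), h₆, h₇, h₈]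

theorem transfers_threeL_threeR : Transfers threeL threeR X := by
  intro o o' hb f hf
  obtain ⟨h₁₃, h₁₂, h₂₃⟩ := (threeL_isColoring_iff o f).1 hf
  obtain ⟨b₆, b₇, b₈, k₁₂, k₁₃, k₂₃⟩ := tripleSlides _ _ _ h₁₂ h₁₃ h₂₃
  rw [hb, hb] at k₁₂ k₁₃ k₂₃
  refine ⟨(![f (0 : Fin 9), f (1 : Fin 9), f (2 : Fin 9), f (3 : Fin 9), f (4 : Fin 9),
    f (5 : Fin 9), b₆, b₇, b₈] : Fin 9 → X), (threeR_isColoring_iff o' _).2 ⟨k₁₃, k₁₂, k₂₃⟩,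
    fun i => ?_⟩
  change Fin 6 at i
  fin_cases i <;> rfl

theorem transfers_threeR_threeL : Transfers threeR threeL X := by
  intro o o' hb f hf
  obtain ⟨h₁₃, h₁₂, h₂₃⟩ := (threeR_isColoring_iff o f).1 hf
  obtain ⟨b₆, b₇, b₈, k₁₂, k₁₃, k₂₃⟩ :=
    tripleSlides _ _ _ (reverse.1 h₁₂) (reverse.1 h₁₃) (reverse.1 h₂₃)
  rw [hb, hb] at k₁₂ k₁₃ k₂₃
  refine ⟨(![f (0 : Fin 9), f (1 : Fin 9), f (2 : Fin 9), f (3 : Fin 9), f (4 : Fin 9),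
    f (5 : Fin 9), b₆, b₇, b₈] : Fin 9 → X),
    (threeL_isColoring_iff o' _).2 ⟨reverse.2 k₁₃, reverse.2 k₁₂, reverse.2 k₂₃⟩, fun i => ?_⟩
  change Fin 6 at i
  fin_cases i <;> rfl

theorem interchangeable_three : Interchangeable threeL threeR X :=
  ⟨transfers_threeL_threeR, transfers_threeR_threeL, rigid_threeL, rigid_threeR⟩

theorem rigid_fourL : Rigid fourL X :=
  fun _ _ _ _ _ h => funext (forall_fin_three.2 ⟨h (0 : Fin 3), h (1 : Fin 3), h (2 : Fin 3)⟩)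

theorem rigid_fourR : Rigid fourR X := by
  intro o f g hf hg h
  obtain ⟨hf, -⟩ := (fourR_isColoring_iff o f).1 hf
  obtain ⟨hg, -⟩ := (fourR_isColoring_iff o g).1 hg
  obtain ⟨h₄, h₃⟩ := hf.unique₂₃ hg (h (1 : Fin 3)) (h (2 : Fin 3))
  funext i
  change Fin 5 at i
  fin_cases i
  exacts [h (0 : Fin 3), h (1 : Fin 3), h (2 : Fin 3), h₃, h₄]

theorem transfers_fourL_fourR : Transfers fourL fourR X := by
  intro o o' hb f hf
  have h := (fourL_isColoring_iff o f).1 hf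
  obtain ⟨a, b, k⟩ := exists₂₃ (o'.inB 1) (o'.inB 2) (f (1 : Fin 3)) (f (2 : Fin 3))
  rw [hb, hb, hb, ← k.twist_iff] at h
  exact ⟨(![f (0 : Fin 3), f (1 : Fin 3), f (2 : Fin 3), b, a] : Fin 5 → X),
    (fourR_isColoring_iff o' _).2 ⟨k, h⟩, forall_fin_three.2 ⟨rfl, rfl, rfl⟩⟩

theorem transfers_fourR_fourL : Transfers fourR fourL X := by
  intro o o' hb f hf
  obtain ⟨k, h⟩ := (fourR_isColoring_iff o f).1 hf
  rw [k.twist_iff, hb, hb, hb] at h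
  exact ⟨(![f (0 : Fin 5), f (1 : Fin 5), f (2 : Fin 5)] : Fin 3 → X),
    (fourL_isColoring_iff o' _).2 h, forall_fin_three.2 ⟨rfl, rfl, rfl⟩⟩

theorem interchangeable_four : Interchangeable fourL fourR X :=
  ⟨transfers_fourL_fourR, transfers_fourR_fourL, rigid_fourL, rigid_fourR⟩

theorem rigid_fiveL : Rigid fiveL X := by
  intro o f g hf hg h
  obtain ⟨hf, -⟩ := (fiveL_isColoring_iff o f).1 hf
  obtain ⟨hg, -⟩ := (fiveL_isColoring_iff o g).1 hg
  obtain ⟨h₅, -⟩ := hf.unique₀₁ hg (h (0 : Fin 5)) (h (1 : Fin 5))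
  funext i
  change Fin 6 at i
  fin_cases i
  exacts [h (0 : Fin 5), h (1 : Fin 5), h (2 : Fin 5), h (3 : Fin 5), h (4 : Fin 5), h₅]

theorem rigid_fiveR : Rigid fiveR X := by
  intro o f g hf hg h
  obtain ⟨⟨hf, hf'⟩, -⟩ := (fiveR_isColoring_iff o f).1 hf
  obtain ⟨⟨hg, hg'⟩, -⟩ := (fiveR_isColoring_iff o g).1 hg
  obtain ⟨h₆, h₇⟩ := hf'.unique₂₃ hg' (h (3 : Fin 5)) (h (4 : Fin 5))
  obtain ⟨h₅, -⟩ := hf.unique₁₂ hg (h (1 : Fin 5)) (h (2 : Fin 5))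
  funext i
  change Fin 8 at i
  fin_cases i
  exacts [h (0 : Fin 5), h (1 : Fin 5), h (2 : Fin 5), h (3 : Fin 5), h (4 : Fin 5), h₅, h₆, h₇]

theorem transfers_fiveL_fiveR : Transfers fiveL fiveR X := by
  intro o o' hb f hf
  obtain ⟨a, b, z, k⟩ := pass_iff.1 ⟨_, (fiveL_isColoring_iff o f).1 hf⟩
  rw [hb, hb, hb, hb] at k
  refine ⟨(![f (0 : Fin 6), f (1 : Fin 6), f (2 : Fin 6), f (3 : Fin 6), f (4 : Fin 6), b, a, z] :
    Fin 8 → X), (fiveR_isColoring_iff o' _).2 k, fun i => ?_⟩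
  change Fin 5 at i
  fin_cases i <;> rfl

theorem transfers_fiveR_fiveL : Transfers fiveR fiveL X := by
  intro o o' hb f hf
  obtain ⟨d, k⟩ := pass_iff.2 ⟨_, _, _, (fiveR_isColoring_iff o f).1 hf⟩
  rw [hb, hb, hb, hb] at k
  refine ⟨(![f (0 : Fin 8), f (1 : Fin 8), f (2 : Fin 8), f (3 : Fin 8), f (4 : Fin 8), d] :
    Fin 6 → X), (fiveL_isColoring_iff o' _).2 k, fun i => ?_⟩
  change Fin 5 at i
  fin_cases i <;> rfl

theorem interchangeable_five : Interchangeable fiveL fiveR X :=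
  ⟨transfers_fiveL_fiveR, transfers_fiveR_fiveL, rigid_fiveL, rigid_fiveR⟩

theorem rigid_sixL : Rigid sixL X := by
  intro o f g hf hg h
  have h₀ : f (0 : Fin 5) = g (0 : Fin 5) := h (0 : Fin 4)
  have h₁ : f (1 : Fin 5) = g (1 : Fin 5) := h (1 : Fin 4)
  obtain ⟨hf, -⟩ := (sixL_isColoring_iff o f).1 hf
  obtain ⟨hg, -⟩ := (sixL_isColoring_iff o g).1 hg
  rw [h₀, h₁] at hf
  have h₄ := (signed_involutive _).injective (hf.unique hg)
  funext i
  change Fin 5 at i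
  fin_cases i
  exacts [h₀, h₁, h (2 : Fin 4), h (3 : Fin 4), h₄]

theorem rigid_sixR : Rigid sixR X := by
  intro o f g hf hg h
  have h₀ : f (0 : Fin 5) = g (0 : Fin 5) := h (0 : Fin 4)
  have h₃ : f (3 : Fin 5) = g (3 : Fin 5) := h (3 : Fin 4)
  obtain ⟨hf, -⟩ := (sixR_isColoring_iff o f).1 hf
  obtain ⟨hg, -⟩ := (sixR_isColoring_iff o g).1 hg
  rw [h₀, h₃] at hf
  have h₄ := (signed_involutive _).injective (hf.unique hg)
  funext i
  change Fin 5 at i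
  fin_cases i
  exacts [h₀, h (1 : Fin 4), h (2 : Fin 4), h₃, h₄]

theorem transfers_sixL_sixR : Transfers sixL sixR X := by
  intro o o' hb f hf
  obtain ⟨a, k⟩ := (VertexRule.signed_exchange_iff _ (o'.inV (0 : Fin 2) 2)).1
    ⟨_, (sixL_isColoring_iff o f).1 hf⟩
  rw [hb, hb, hb, hb] at k
  refine ⟨(![f (0 : Fin 5), f (1 : Fin 5), f (2 : Fin 5), f (3 : Fin 5), a] : Fin 5 → X),
    (sixR_isColoring_iff o' _).2 k, fun i => ?_⟩
  change Fin 4 at i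
  fin_cases i <;> rfl

theorem transfers_sixR_sixL : Transfers sixR sixL X := by
  intro o o' hb f hf
  obtain ⟨a, k⟩ := (VertexRule.signed_exchange_iff (o'.inV (0 : Fin 2) 2) _).2
    ⟨_, (sixR_isColoring_iff o f).1 hf⟩
  rw [hb, hb, hb, hb] at k
  refine ⟨(![f (0 : Fin 5), f (1 : Fin 5), f (2 : Fin 5), f (3 : Fin 5), a] : Fin 5 → X),
    (sixL_isColoring_iff o' _).2 k, fun i => ?_⟩
  change Fin 4 at i
  fin_cases i <;> rfl

theorem interchangeable_six : Interchangeable sixL sixR X :=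
  ⟨transfers_sixL_sixR, transfers_sixR_sixL, rigid_sixL, rigid_sixR⟩

end BasicMoves

theorem BasicMove.interchangeable (h : BasicMove P Q) : Interchangeable P Q X := by
  cases h
  exacts [interchangeable_one, interchangeable_two, interchangeable_three, interchangeable_four,
    interchangeable_five, interchangeable_six]

end Picture

/-- The partially multiplicative biquandle with the two biquandle operations exchanged, which
turns colorings of a diagram into colorings of its mirror image. -/
def OverUnderSwap (X : Type u) : Type u := X

namespace OverUnderSwap

open Biquandle PartiallyMultiplicativeBiquandle

instance (X : Type u) [Biquandle X] : Biquandle (OverUnderSwap X) where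
  passUnder := passOver (X := X)
  passOver := passUnder (X := X)
  under_self x := (under_self (X := X) x).symm
  over_bijective := under_bijective (X := X)
  under_bijective := over_bijective (X := X)
  switch_bijective := (Equiv.prodComm X X).bijective.comp
    ((switch_bijective (X := X)).comp (Equiv.prodComm X X).bijective)
  exchange_uu := exchange_oo (X := X)
  exchange_uo x y z := (exchange_uo (X := X) x z y).symm
  exchange_oo := exchange_uu (X := X)

instance (X : Type u) [PartiallyMultiplicativeBiquandle X] :
    PartiallyMultiplicativeBiquandle (OverUnderSwap X) where
  D := D (X := X)
  mul := mul (X := X)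
  mul_left_injective := mul_left_injective (X := X)
  mul_right_injective := mul_right_injective (X := X)
  D_swap a b := (D_swap (X := X) b a).symm
  mul_swap a b h h' := (mul_swap (X := X) b a h' h).symm
  D_under := D_over (X := X)
  D_over := D_under (X := X)
  under_mul := over_mul (X := X)
  over_mul := under_mul (X := X)
  mul_under := mul_over (X := X)
  mul_over := mul_under (X := X)
  D_assoc := D_assoc (X := X)
  mul_assoc := PartiallyMultiplicativeBiquandle.mul_assoc (X := X)
  mul_eq_mul_iff := mul_eq_mul_iff (X := X)

end OverUnderSwap

theorem crossingRule_overUnderSwap_iff {X : Type u} [Biquandle X] {s t : Bool} {a b c d : X} :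
    CrossingRule (X := OverUnderSwap X) (!t) s a b c d ↔ CrossingRule s t b c d a := by
  cases s <;> cases t <;> exact and_comm

namespace Picture

variable {n : ℕ} {P Q : Picture n} {X : Type u} [PartiallyMultiplicativeBiquandle X]

/-- The port of `P.mirror` which is the port `p` of `P`: mirroring turns every crossing by a
quarter, so that its ports `0` and `2` are again those of the under-strand. -/
def mirrorPort {C V : Type} : Port C V n ≃ Port C V n :=
  Equiv.sumCongr (Equiv.prodCongr (Equiv.refl C) (Equiv.subRight (1 : Fin 4))) (Equiv.refl _)

theorem arc_mirrorPort (p : Port P.C P.V n) : P.mirror.arc (mirrorPort p) = P.arc p := by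
  rcases p with ⟨c, i⟩ | p
  · exact congrArg (fun i => P.arc (Sum.inl (c, i))) (sub_add_cancel i 1)
  · rfl

/-- The orientation of a picture which corresponds to an orientation of its mirror image. -/
def YOrientation.unmirror (o : P.mirror.YOrientation) : P.YOrientation where
  inward p := o.inward (mirrorPort p)
  arc_dir p q hpq h := o.arc_dir _ _ (mirrorPort.injective.ne hpq) <|
    (arc_mirrorPort p).trans (h.trans (arc_mirrorPort q).symm)
  crossing_dir c i := by
    have h := o.crossing_dir c (i - 1)
    rwa [sub_add_eq_add_sub] at h
  vertex_dir v := o.vertex_dir v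

theorem YOrientation.isColoring_unmirror_iff (o : P.mirror.YOrientation) (f : P.E → X) :
    o.unmirror.IsColoring (X := OverUnderSwap X) f ↔ o.IsColoring f := by
  refine (o.unmirror.isColoring_iff_crossingRule (X := OverUnderSwap X) f).trans
    (Iff.trans (and_congr_left' (forall_congr' fun c => ?_)) (o.isColoring_iff_crossingRule f).symm)
  have inC_zero : o.unmirror.inC c 0 = !o.inC c 1 := o.inC_add_two c 1
  rw [inC_zero]
  exact crossingRule_overUnderSwap_iff

theorem Rigid.mirror (h : Rigid P (OverUnderSwap X)) : Rigid P.mirror X :=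
  fun o f g hf hg hb => h o.unmirror f g ((o.isColoring_unmirror_iff f).2 hf)
    ((o.isColoring_unmirror_iff g).2 hg) hb

theorem Transfers.mirror (h : Transfers P Q (OverUnderSwap X)) :
    Transfers P.mirror Q.mirror X := by
  intro o o' hb f hf
  obtain ⟨g, hg, hgf⟩ := h o.unmirror o'.unmirror hb f ((o.isColoring_unmirror_iff f).2 hf)
  exact ⟨g, (o'.isColoring_unmirror_iff (X := X) g).1 hg, hgf⟩

theorem Interchangeable.mirror (h : Interchangeable P Q (OverUnderSwap X)) :
    Interchangeable P.mirror Q.mirror X :=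
  ⟨h.transfers.mirror, h.transfers_symm.mirror, h.rigid_left.mirror, h.rigid_right.mirror⟩

theorem Interchangeable.symm (h : Interchangeable P Q X) : Interchangeable Q P X :=
  ⟨h.transfers_symm, h.transfers, h.rigid_right, h.rigid_left⟩

theorem LocalMove.symm (h : LocalMove P Q) : LocalMove Q P := by
  cases h with
  | basic h => exact .basic_symm h
  | basic_symm h => exact .basic h
  | mirror h => exact .mirror_symm h
  | mirror_symm h => exact .mirror h

theorem LocalMove.interchangeable (h : LocalMove P Q) : Interchangeable P Q X := by
  cases h with
  | basic h => exact h.interchangeable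
  | basic_symm h => exact h.interchangeable.symm
  | mirror h => exact h.interchangeable.mirror
  | mirror_symm h => exact h.interchangeable.mirror.symm

end Picture

namespace Gluing

variable {Γ : YDiagram} {n : ℕ} {T P : Picture n} {o : T.YOrientation} {o' : P.YOrientation}

theorem arc_boundary (G : Gluing Γ o o') (i : Fin n) :
    G.arc (Sum.inl (T.arcB i)) = G.arc (Sum.inr (P.arcB i)) :=
  (G.arc_eq_iff _ _).2 (.rel _ _ ⟨i, rfl, rfl⟩)

theorem isColoring_iff (G : Gluing Γ o o') {X : Type u} [PartiallyMultiplicativeBiquandle X]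
    (f : Γ.E → X) : Γ.orient.IsColoring f ↔
      o.IsColoring (fun e => f (G.arc (Sum.inl e))) ∧
        o'.IsColoring (fun e => f (G.arc (Sum.inr e))) := by
  simp only [Picture.YOrientation.isColoring_iff, ← G.crossing.forall_congr_right,
    ← G.vertex.forall_congr_right, Sum.forall, G.arc_crossing_outer, G.arc_crossing_inner,
    G.arc_vertex_outer, G.arc_vertex_inner, G.dir_crossing_outer, G.dir_crossing_inner,
    G.dir_vertex_outer, G.dir_vertex_inner]
  exact and_and_and_comm

theorem exists_glue (G : Gluing Γ o o') {Y : Type*} (f : T.E → Y) (g : P.E → Y)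
    (h : ∀ i, g (P.arcB i) = f (T.arcB i)) :
    ∃ k : Γ.E → Y, (∀ e, k (G.arc (Sum.inl e)) = f e) ∧ ∀ e, k (G.arc (Sum.inr e)) = g e := by
  have factors : ∀ x y, G.arc x = G.arc y → Sum.elim f g x = Sum.elim f g y := fun x y hxy =>
    (Equivalence.eqvGen_iff (Setoid.ker (Sum.elim f g)).iseqv).1 <|
      Relation.EqvGen.mono (by rintro _ _ ⟨i, rfl, rfl⟩; exact (h i).symm) _ _
        ((G.arc_eq_iff x y).1 hxy)
  have factor (x) : Sum.elim f g (Function.surjInv G.arc_surjective (G.arc x)) = Sum.elim f g x :=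
    factors _ _ (Function.surjInv_eq G.arc_surjective _)
  exact ⟨Sum.elim f g ∘ Function.surjInv G.arc_surjective, fun e => factor (.inl e),
    fun e => factor (.inr e)⟩

end Gluing

namespace HandlebodyMove

variable {Γ Γ' : YDiagram} {X : Type u} [PartiallyMultiplicativeBiquandle X]

/-- The inverse of a handlebody-knot Reidemeister move. -/
def symm (m : HandlebodyMove Γ Γ') : HandlebodyMove Γ' Γ where
  n := m.n
  outer := m.outer
  inner := m.inner'
  inner' := m.inner
  isMove := m.isMove.symm
  outerOrient := m.outerOrient
  innerOrient := m.innerOrient'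
  innerOrient' := m.innerOrient
  source := m.target
  target := m.source

theorem agree_symm_iff (m : HandlebodyMove Γ Γ') {f : Γ.Coloring X} {f' : Γ'.Coloring X} :
    m.symm.Agree f' f ↔ m.Agree f f' :=
  forall_congr' fun _ => eq_comm

theorem innerOrient_inB_eq (m : HandlebodyMove Γ Γ') (i : Fin m.n) :
    m.innerOrient.inB i = m.innerOrient'.inB i :=
  Bool.not_inj ((Bool.eq_not.2 (m.source.dir_boundary i)).symm.trans
    (Bool.eq_not.2 (m.target.dir_boundary i)))

theorem exists_agree (m : HandlebodyMove Γ Γ') (f : Γ.Coloring X) :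
    ∃ f' : Γ'.Coloring X, m.Agree f f' := by
  obtain ⟨hT, hP⟩ := (m.source.isColoring_iff f.1).1 f.2
  obtain ⟨g, hg, hb⟩ :=
    m.isMove.interchangeable.transfers m.innerOrient m.innerOrient' m.innerOrient_inB_eq _ hP
  obtain ⟨k, hk, hk'⟩ := m.target.exists_glue (fun e => f.1 (m.source.arc (Sum.inl e))) g
    fun i => (hb i).trans (congrArg f.1 (m.source.arc_boundary i)).symm
  exact ⟨⟨k, (m.target.isColoring_iff k).2
    ⟨by simpa only [hk] using hT, by simpa only [hk'] using hg⟩⟩, hk⟩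

theorem agree_unique (m : HandlebodyMove Γ Γ') {f : Γ.Coloring X} {f₁ f₂ : Γ'.Coloring X}
    (h₁ : m.Agree f f₁) (h₂ : m.Agree f f₂) : f₁ = f₂ := by
  have outer_eq (e) : f₁.1 (m.target.arc (Sum.inl e)) = f₂.1 (m.target.arc (Sum.inl e)) :=
    (h₁ e).trans (h₂ e).symm
  have inner_eq := m.isMove.interchangeable.rigid_right m.innerOrient' _ _
    ((m.target.isColoring_iff f₁.1).1 f₁.2).2 ((m.target.isColoring_iff f₂.1).1 f₂.2).2 fun i => by
      rw [← m.target.arc_boundary, outer_eq]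
  refine Subtype.ext (funext fun e => ?_)
  obtain ⟨e | e, rfl⟩ := m.target.arc_surjective e
  exacts [outer_eq e, congrFun inner_eq e]

theorem existsUnique_agree (m : HandlebodyMove Γ Γ') (f : Γ.Coloring X) :
    ∃! f' : Γ'.Coloring X, m.Agree f f' :=
  existsUnique_of_exists_of_unique (m.exists_agree f) fun _ _ => m.agree_unique

theorem mk_coloring_eq (m : HandlebodyMove Γ Γ') :
    Cardinal.mk (Γ.Coloring X) = Cardinal.mk (Γ'.Coloring X) := by
  choose φ hφ using fun f : Γ.Coloring X => m.exists_agree f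
  choose ψ hψ using fun f : Γ'.Coloring X => m.symm.exists_agree f
  exact Cardinal.mk_congr ⟨φ, ψ,
    fun f => m.symm.agree_unique (hψ (φ f)) (m.agree_symm_iff.2 (hφ f)),
    fun f => m.agree_unique (hφ (ψ f)) (m.agree_symm_iff.1 (hψ f))⟩

end HandlebodyMove

theorem proposition5p2 {X : Type u} [PartiallyMultiplicativeBiquandle X] :
    (∀ (Γ Γ' : YDiagram) (m : HandlebodyMove Γ Γ') (f : Γ.Coloring X),
      ∃! f' : Γ'.Coloring X, m.Agree f f') ∧
    (∀ Γ Γ' : YDiagram, HandlebodyEquiv Γ Γ' →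
      Cardinal.mk (Γ.Coloring X) = Cardinal.mk (Γ'.Coloring X)) := by
  refine ⟨fun _ _ m f => m.existsUnique_agree f, fun Γ Γ' h => ?_⟩
  induction h with
  | rel _ _ h => exact h.elim HandlebodyMove.mk_coloring_eq
  | refl => rfl
  | symm _ _ _ ih => exact ih.symm
  | trans _ _ _ _ _ ih₁ ih₂ => exact ih₁.trans ih₂
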